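/- **Setting.** Let $\Omega\subset\mathbb R^d$ be a bounded domain and let $\mathbb L u=\sum_{i,j}\partial_i(a_{ij}\partial_j u)-cu$ be a symmetric, uniformly elliptic operator with $a_{ij}\in C^1(\overline\Omega)$, $c\in C(\overline\Omega)$ and homogeneous Dirichlet boundary conditions (domain $H^2(\Omega)\cap H^1_0(\Omega)$). Let $(\varphi_k)_{k\ge1}$ be an orthonormal basis of $L^2(\Omega)$ consisting of eigenfunctions of $-\mathbb L$, with eigenvalues $0<\lambda_1\le\lambda_2\le\dots$ counted with multiplicity. Write $\dot H^{r}=\{v\in L^2(\Omega):\sum_k\lambda_k^{r}\langle v,\varphi_k\rangle^2<\infty\}$, $f(-\mathbb L)v=\sum_k f(\lambda_k)\langle v,\varphi_k\rangle\varphi_k$, and $E_{\alpha,1}(z)=\sum_{k\ge0}z^k/\Gamma(\alpha k+1)$. Let $T>0$, $p\in(1,\infty)$, $0\neq u_0\in\dot H^{2(1+2/p)}$, and $g=\exp(\mathbb LT)u_0$. Let $s\ge1+\frac1p$, and let $\mu>0$ be such that $A=\mu(-\mathbb L)^{-2s}$ satisfies $\|A\|_{L^2\to L^2}\le1$. For data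 $g^\delta\in L^2(\Omega)$ and an index $i_*\in\mathbb N$ let $\tilde g^\delta=w^{(i_*)}$, where $w^{(0)}=0$ and $w^{(i+1)}=w^{(i)}-A(w^{(i)}-g^\delta)$. Put $$u_0^\delta(\alpha)=\sum_{k=1}^\infty\frac{\langle\tilde g^\delta,\varphi_k\rangle}{E_{\alpha,1}(-\lambda_kT^\alpha)}\,\varphi_k,\qquad \alpha\in(0,1),$$ fix an arbitrary constant $C_2>0$, and let $\tilde\delta=C_2T^{-1}\delta\sqrt{\log(\|u_0\|_{L^2}/\delta)}$ (with the root read as $0$ if $\delta\ge\|u_0\|_{L^2}$). For fixed $1<\underline\tau<\overline\tau$ the discrepancy principle for $\alpha\in(0,1)$ is $$\underline\tau\,\tilde\delta\le\|\exp(\mathbb LT)u_0^\delta(\alpha)-\tilde g^\delta\|_{L^2}\le\overline\tau\,\tilde\delta.\tag{DP}$$ **Theorem.** 1. (Well-definedness.) For all $g^\delta\in L^2(\Omega)$, $i_*\in\mathbb N$ and $\alpha\in(0,1)$ the series defining $u_0^\delta(\alpha)$ converges in $L^2(\Omega)$. 2. (Existence of $\alpha$.) Let $0<\delta<\|u_0\|_{L^2}$,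 $g^\delta\in L^2(\Omega)$, $i_*\in\mathbb N$, and suppose that the signal-to-noise condition $\|\tilde g^\delta\|_{L^2}>\hat\tau\,\tilde\delta$ holds, either with $\hat\tau=\overline\tau/\kappa$ for some $\kappa>0$ such that $|1-(1+\lambda_k)e^{-\lambda_kT}|\ge\kappa$ for all $k$; or, in the case $T\ge1$, with $\hat\tau=\overline\tau/\bigl(1-(1+\lambda_1T)e^{-\lambda_1T}\bigr)$. Then there is an $\alpha\in(0,1)$ that satisfies (DP). 3. (Convergence.) Let $\delta_n>0$, $\delta_n\to0$, let $g^{\delta_n}\in L^2(\Omega)$ satisfy $\|g-g^{\delta_n}\|_{L^2}\le\delta_n$, let $i_*=i_*(n)\sim T^{-2}\log(\|u_0\|_{L^2}/\delta_n)$ (that is, the quotient of the two sides is bounded above and bounded away from zero for all large $n$), and let $\alpha_n\in(0,1)$ satisfy (DP) with $\delta=\delta_n$ and $g^\delta=g^{\delta_n}$ for all large $n$. Then $$u_0^{\delta_n}(\alpha_n)\rightharpoonup u_0\quad\text{weakly in }L^2(\Omega)\text{ as }n\to\infty.$$ -/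

import Mathlib

open Filter Topology MeasureTheory Asymptotics
open scoped RealInnerProductSpace ContDiff

noncomputable section

/-! ### The Dirichlet realization of a second order elliptic operator -/

/-- The Euclidean space of dimension `d`. -/
abbrev EucSp (d : ℕ) : Type := EuclideanSpace ℝ (Fin d)

/-- The real Hilbert space `L²(Ω)`. -/
abbrev L2 {d : ℕ} (Ω : Set (EucSp d)) : Type := Lp ℝ 2 (volume.restrict Ω)

/-- Test functions: the space `C_c^∞(Ω)`. -/
def IsTest {d : ℕ} (Ω : Set (EucSp d)) (v : EucSp d → ℝ) : Prop :=
  ContDiff ℝ ∞ v ∧ HasCompactSupport v ∧ tsupport v ⊆ Ω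

/-- The classical partial derivative in the `i`-th coordinate direction. -/
def pderiv {d : ℕ} (i : Fin d) (v : EucSp d → ℝ) (x : EucSp d) : ℝ :=
  fderiv ℝ v x (EuclideanSpace.single i 1)

/-- `w` is the weak `i`-th partial derivative of `u` in `Ω`. -/
def HasWeakPDeriv {d : ℕ} {Ω : Set (EucSp d)} (i : Fin d) (u w : L2 Ω) : Prop :=
  ∀ v : EucSp d → ℝ, IsTest Ω v →
    ∫ x in Ω, u x * pderiv i v x = -∫ x in Ω, w x * v x

/-- The Sobolev space `H²(Ω)`. -/
def MemH2 {d : ℕ} {Ω : Set (EucSp d)} (u : L2 Ω) : Prop :=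
  ∃ (G : Fin d → L2 Ω) (D : Fin d → Fin d → L2 Ω),
    (∀ i, HasWeakPDeriv i u (G i)) ∧ ∀ i j, HasWeakPDeriv i (G j) (D i j)

/-- The Sobolev space `H¹₀(Ω)`: the closure of `C_c^∞(Ω)` in the `H¹` norm. -/
def MemH10 {d : ℕ} {Ω : Set (EucSp d)} (u : L2 Ω) : Prop :=
  ∃ G : Fin d → L2 Ω, ∀ ε : ENNReal, 0 < ε → ∃ v : EucSp d → ℝ, IsTest Ω v ∧
    eLpNorm (fun x => v x - u x) 2 (volume.restrict Ω) < ε ∧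
    ∀ i, eLpNorm (fun x => pderiv i v x - G i x) 2 (volume.restrict Ω) < ε

/-- The coefficients of a symmetric, uniformly elliptic second order operator
`L u = ∑ i j, ∂_i (a_ij ∂_j u) - c u` on `Ω`. -/
structure EllipticOp {d : ℕ} (Ω : Set (EucSp d)) where
  /-- the leading coefficients -/
  a : EucSp d → Matrix (Fin d) (Fin d) ℝ
  /-- the zeroth order coefficient -/
  c : EucSp d → ℝ
  a_smooth : ∀ i j, ContDiffOn ℝ 1 (fun x => a x i j) (closure Ω)
  c_cont : ContinuousOn c (closure Ω)
  a_symm : ∀ x ∈ Ω, ∀ i j, a x i j = a x j i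
  elliptic : ∃ ν : ℝ, 0 < ν ∧ ∀ x ∈ Ω, ∀ ξ : EucSp d,
    ν * ‖ξ‖ ^ 2 ≤ ∑ i, ∑ j, a x i j * ξ i * ξ j

/-- `u` lies in the domain `H²(Ω) ∩ H¹₀(Ω)` of `L` and `-L u = f`. -/
def EllipticOp.NegEq {d : ℕ} {Ω : Set (EucSp d)} (L : EllipticOp Ω) (u f : L2 Ω) : Prop :=
  MemH2 u ∧ MemH10 u ∧ ∃ G : Fin d → L2 Ω, (∀ i, HasWeakPDeriv i u (G i)) ∧
    ∀ v : EucSp d → ℝ, IsTest Ω v →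
      (∑ i, ∑ j, ∫ x in Ω, L.a x i j * G j x * pderiv i v x)
        + ∫ x in Ω, L.c x * u x * v x = ∫ x in Ω, f x * v x

/-- `φ`, `lam` are an orthonormal basis of `L²(Ω)` of Dirichlet eigenfunctions of `-L` and the
corresponding eigenvalues, positive, with multiplicities and enumerated in nondecreasing order.
The index starts at `0`, so the smallest eigenvalue is `lam 0`. -/
def EllipticOp.IsEigenSystem {d : ℕ} {Ω : Set (EucSp d)} (L : EllipticOp Ω)
    (φ : HilbertBasis ℕ ℝ (L2 Ω)) (lam : ℕ → ℝ) : Prop :=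
  (∀ k, L.NegEq (φ k) (lam k • φ k)) ∧ (∀ k, 0 < lam k) ∧ Monotone lam

/-! ### Functions of the operator through its eigensystem -/

section Spectral

variable {H : Type*} [NormedAddCommGroup H] [InnerProductSpace ℝ H]

/-- The operator `v ↦ ∑ k, m k ⟨φ k, v⟩ φ k`. -/
def specMul (φ : HilbertBasis ℕ ℝ H) (m : ℕ → ℝ) (v : H) : H :=
  ∑' k, (m k * ⟪φ k, v⟫) • φ k

/-- The space `Ḣ^r`. -/
def MemHdot (φ : HilbertBasis ℕ ℝ H) (lam : ℕ → ℝ) (r : ℝ) (v : H) : Prop :=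
  Summable fun k => lam k ^ r * ⟪φ k, v⟫ ^ 2

/-- The diffusion semigroup `exp(L t)`. -/
def heatSemigroup (φ : HilbertBasis ℕ ℝ H) (lam : ℕ → ℝ) (t : ℝ) (v : H) : H :=
  specMul φ (fun k => Real.exp (-lam k * t)) v

/-- The smoothing operator `A = μ (-L)^(-2s)`. -/
def smoothingOp (φ : HilbertBasis ℕ ℝ H) (lam : ℕ → ℝ) (s μ : ℝ) (v : H) : H :=
  μ • specMul φ (fun k => lam k ^ (-(2 * s))) v

/-- Landweber iteration `w⁽ⁱ⁺¹⁾ = w⁽ⁱ⁾ - A (w⁽ⁱ⁾ - gδ)`, `w⁽⁰⁾ = 0`. -/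
def landweber (φ : HilbertBasis ℕ ℝ H) (lam : ℕ → ℝ) (s μ : ℝ) (gδ : H) : ℕ → H
  | 0 => 0
  | i + 1 => landweber φ lam s μ gδ i
      - smoothingOp φ lam s μ (landweber φ lam s μ gδ i - gδ)

/-- The two-parameter Mittag-Leffler function on the real line. -/
def mittagLeffler (α β x : ℝ) : ℝ := ∑' k : ℕ, x ^ k / Real.Gamma (α * k + β)

/-- The amplification factors `1 / E_{α,1}(-λ_k T^α)` of backward subdiffusion. -/
def ampFrac (lam : ℕ → ℝ) (T α : ℝ) (k : ℕ) : ℝ :=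
  1 / mittagLeffler α 1 (-(lam k * T ^ α))

/-- The subdiffusion reconstruction of the initial value from the final data `gt`. -/
def subdiffRec (φ : HilbertBasis ℕ ℝ H) (lam : ℕ → ℝ) (T α : ℝ) (gt : H) : H :=
  specMul φ (ampFrac lam T α) gt

/-- The level `C₂ T⁻¹ δ √(log (‖u₀‖ / δ))` of the noise in the smoothed data. -/
def smoothedLevel (C₂ T : ℝ) (u₀ : H) (δ : ℝ) : ℝ :=
  C₂ * T⁻¹ * δ * √(Real.log (‖u₀‖ / δ))

/-- The discrepancy principle
`τ₁ dt ≤ ‖exp(L T) u₀^δ(α) - gt‖ ≤ τ₂ dt` for the parameter `α ∈ (0,1)`. -/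
def Discrepancy (φ : HilbertBasis ℕ ℝ H) (lam : ℕ → ℝ) (T τ₁ τ₂ dt : ℝ) (gt : H)
    (α : ℝ) : Prop :=
  0 < α ∧ α < 1 ∧
    τ₁ * dt ≤ ‖heatSemigroup φ lam T (subdiffRec φ lam T α gt) - gt‖ ∧
    ‖heatSemigroup φ lam T (subdiffRec φ lam T α gt) - gt‖ ≤ τ₂ * dt

end Spectral

end

/-! ### Estimates for the Gamma function and the beta integral -/

/-! Everything reduces to scalar estimates on coefficients in the eigenbasis. The reconstruction
multiplies the `k`-th coefficient of the smoothed data by `1 / E_{α,1}(-λ_k T^α)`, and the residual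
in the discrepancy principle has the multiplier `m_k(α) = e^{-λ_k T} / E_{α,1}(-λ_k T^α) - 1`.

The Mittag-Leffler input is real-variable. Nonnegativity of `E_{α,α}` on the negative half-line
(`mittagLeffler_self_nonneg`) makes `t ↦ E_{α,1}(-t^α)` decreasing and yields two algebraic bounds
and an exponential lower bound. These give `e^{-lT} / E_{α,1}(-l T^α) ≤ C` uniformly in `α` and `l`
(`exists_exp_div_mittagLeffler_le`). Comparing fractional with ordinary integrals bounds
`|E_{α,1}(-l T^α) - e^{-lT}|` by a multiple of `(1 - α)(1 + l)` (`abs_mittagLeffler_sub_exp_le`).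

Existence: `m_k` tends to `0` as `α → 1` and to `(1 + λ_k) e^{-λ_k T} - 1` as `α → 0`. Dominated
convergence carries this over to the residual norm, and the signal-to-noise condition makes the
intermediate value theorem applicable.

Convergence: the residual is `O(1 - α)` on exact data, at the price of one power of `λ_k`, and
`O(δ)` on the noise. The level `δ √log` dominates `δ`, so the lower discrepancy bound forces `δ √log
≤ M (1 - α)`. Noise is amplified by at most a constant times `1 + √i / (1 - α)` with `√i ≲ √log`, so
the reconstructions stay bounded. The upper discrepancy bound sends the residual to zero, which
identifies the limit of every coefficient; together with boundedness this is weak convergence. -/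

/-- Restrict the Gamma integral to `x > R`, where `x ^ y ≥ R ^ y`. The free parameter `R` lets `1 /
Γ` beat any geometric growth in the Mittag-Leffler series. -/
theorem rpow_mul_exp_neg_le_Gamma_add_one {y R : ℝ} (hy : 0 < y) (hR : 0 < R) :
    R ^ y * Real.exp (-R) ≤ Real.Gamma (y + 1) := by
  have hint := Real.GammaIntegral_convergent (s := y + 1) (by linarith)
  rw [Real.Gamma_eq_integral (by linarith)]
  have h1 : ∫ x in Set.Ioi R, Real.exp (-x) * R ^ y = R ^ y * Real.exp (-R) := by
    rw [integral_mul_const, integral_exp_neg_Ioi, mul_comm]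
  rw [← h1]
  have hsub : Set.Ioi R ⊆ Set.Ioi 0 := Set.Ioi_subset_Ioi hR.le
  refine le_trans (setIntegral_mono_on ?_ (hint.mono_set hsub) measurableSet_Ioi ?_)
    (setIntegral_mono_set hint ?_ hsub.eventuallyLE)
  · exact (integrableOn_exp_neg_Ioi R).mul_const _
  · intro x hx
    rw [add_sub_cancel_right]
    exact mul_le_mul_of_nonneg_left
      (Real.rpow_le_rpow hR.le (le_of_lt hx) hy.le) (Real.exp_pos _).le
  · refine (ae_restrict_iff' measurableSet_Ioi).2 (Eventually.of_forall fun x hx => ?_)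
    exact mul_nonneg (Real.exp_pos _).le (Real.rpow_nonneg (le_of_lt hx) _)

theorem one_div_Gamma_le {y R : ℝ} (hy : 0 < y) (hR : 0 < R) :
    1 / Real.Gamma y ≤ y * Real.exp R * R ^ (-y) := by
  have h := rpow_mul_exp_neg_le_Gamma_add_one hy hR
  rw [Real.Gamma_add_one hy.ne'] at h
  have hG := Real.Gamma_pos_of_pos hy
  rw [div_le_iff₀ hG, Real.rpow_neg hR.le]
  have hRy := Real.rpow_pos_of_pos hR y
  rw [Real.exp_neg] at h
  have hE := Real.exp_pos R
  field_simp at h ⊢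
  linarith

theorem integral_sub_rpow_mul_rpow {a b t : ℝ} (ha : 0 < a) (hb : 0 < b) (ht : 0 < t) :
    ∫ s in (0 : ℝ)..t, (t - s) ^ (a - 1) * s ^ (b - 1)
      = Real.Gamma a * Real.Gamma b / Real.Gamma (a + b) * t ^ (a + b - 1) := by
  have h := Complex.betaIntegral_scaled b a ht
  rw [← ProbabilityTheory.beta, add_comm a b, mul_comm]
  have h2 : Complex.betaIntegral b a = (ProbabilityTheory.beta a b : ℝ) := by
    rw [Complex.betaIntegral_eq_Gamma_mul_div _ _ (by simpa) (by simpa), ProbabilityTheory.beta,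
      ← Complex.ofReal_add, Complex.Gamma_ofReal, Complex.Gamma_ofReal, Complex.Gamma_ofReal]
    push_cast
    rw [add_comm (b : ℝ) a, mul_comm]
  have h3 : ∫ x in (0 : ℝ)..t, (x : ℂ) ^ ((b : ℂ) - 1) * ((t : ℂ) - x) ^ ((a : ℂ) - 1)
      = ∫ x in (0 : ℝ)..t, (((t - x) ^ (a - 1) * x ^ (b - 1) : ℝ) : ℂ) := by
    refine intervalIntegral.integral_congr fun x hx => ?_
    rw [Set.uIcc_of_le ht.le] at hx
    rw [Complex.ofReal_mul, Complex.ofReal_cpow (by linarith [hx.2]), Complex.ofReal_cpow hx.1]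
    push_cast
    ring
  rw [h3, intervalIntegral.integral_ofReal, h2] at h
  have h4 : ((t : ℂ) ^ ((b : ℂ) + a - 1)) = ((t ^ (b + a - 1) : ℝ) : ℂ) := by
    rw [Complex.ofReal_cpow ht.le]; push_cast; rfl
  rw [h4] at h
  exact_mod_cast h

theorem intervalIntegrable_sub_rpow_mul_rpow {a b t : ℝ} (ha : 0 < a) (hb : 0 < b) (ht : 0 < t) :
    IntervalIntegrable (fun s => (t - s) ^ (a - 1) * s ^ (b - 1)) volume 0 t := by
  -- The integral of a non-integrable function is `0` by convention, so the nonzero beta value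
  -- already proves integrability.
  apply intervalIntegral.intervalIntegrable_of_integral_ne_zero
  rw [integral_sub_rpow_mul_rpow ha hb ht]
  have := Real.Gamma_pos_of_pos ha
  have := Real.Gamma_pos_of_pos hb
  have := Real.Gamma_pos_of_pos (add_pos ha hb)
  positivity

theorem Gamma_le_one {x : ℝ} (h1 : 1 ≤ x) (h2 : x ≤ 2) :
    Real.Gamma x ≤ 1 := by
  have := Real.convexOn_Gamma.2 (Set.mem_Ioi.2 one_pos) (Set.mem_Ioi.2 two_pos)
    (show 0 ≤ 2 - x by linarith) (show 0 ≤ x - 1 by linarith) (by ring)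
  simp only [smul_eq_mul, Real.Gamma_one, Real.Gamma_two] at this
  rw [show (2 - x) * 1 + (x - 1) * 2 = x by ring] at this
  linarith

theorem one_le_Gamma {x : ℝ} (h0 : 0 < x) (h1 : x ≤ 1) : 1 ≤ Real.Gamma x := by
  have := Real.Gamma_strictAntiOn_Ioc.antitoneOn (a := x) (b := 1) ⟨h0, h1⟩ (by simp) h1
  rwa [Real.Gamma_one] at this

theorem Gamma_sub_one_le {x : ℝ} (h0 : 1 / 2 ≤ x) (h1 : x ≤ 1) :
    Real.Gamma x - 1 ≤ 2 * (1 - x) := by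
  have h := Gamma_le_one (x := x + 1) (by linarith) (by linarith)
  rw [Real.Gamma_add_one (by linarith)] at h
  nlinarith [one_le_Gamma (x := x) (by linarith) h1]

theorem le_Gamma_add_one {x : ℝ} (h0 : 0 < x) (h1 : x ≤ 1) : x ≤ Real.Gamma (x + 1) := by
  rw [Real.Gamma_add_one h0.ne']
  nlinarith [one_le_Gamma h0 h1]

theorem Gamma_one_sub_le {x : ℝ} (h0 : 0 < x) (h1 : x < 1) :
    Real.Gamma (1 - x) ≤ 1 / (1 - x) := by
  have h := Gamma_le_one (x := (1 - x) + 1) (by linarith) (by linarith)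
  rw [Real.Gamma_add_one (by linarith)] at h
  rw [le_div_iff₀ (by linarith)]
  linarith

/-! ### The Mittag-Leffler series -/

/-- The majorant is uniform in the order as well as in the argument, so it serves continuity in `x`
and in `α`. -/
theorem exists_mittagLeffler_majorant {a X β : ℝ} (ha : 0 < a) (hX : 0 ≤ X) (hβ : 0 < β) :
    ∃ b : ℕ → ℝ, Summable b ∧ ∀ (k : ℕ) (α x : ℝ), a ≤ α → α ≤ 1 → |x| ≤ X →
      ‖x ^ k / Real.Gamma (α * k + β)‖ ≤ b k := by
  -- With `R ^ a = 2 * X + 1`, each factor `|x| * R ^ (-α)` is at most `1 / 2`, which leaves a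
  -- geometric series with a linear weight.
  set R : ℝ := (2 * X + 1) ^ (1 / a) with hR
  have hR1 : 1 ≤ R := Real.one_le_rpow (by linarith) (by positivity)
  have hR0 : 0 < R := by linarith
  have hRa : R ^ a = 2 * X + 1 := by
    rw [hR, ← Real.rpow_mul (by linarith), one_div_mul_cancel ha.ne', Real.rpow_one]
  refine ⟨fun k => (k + β) * Real.exp R * R ^ (-β) * (1 / 2) ^ k, ?_, fun k α x hα hα1 hx => ?_⟩
  · have h1 : Summable fun k : ℕ => (k : ℝ) ^ 1 * (1 / 2 : ℝ) ^ k :=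
      summable_pow_mul_geometric_of_norm_lt_one 1 (by norm_num)
    have h2 : Summable fun k : ℕ => (1 / 2 : ℝ) ^ k := summable_geometric_two
    refine ((h1.add (h2.mul_left β)).mul_left (Real.exp R * R ^ (-β))).congr fun k => ?_
    ring
  · have hy : 0 < α * k + β := by
      have : 0 ≤ α * k := mul_nonneg (by linarith) k.cast_nonneg
      linarith
    have hG := Real.Gamma_pos_of_pos hy
    rw [norm_div, norm_pow, Real.norm_eq_abs, Real.norm_of_nonneg hG.le, div_eq_mul_one_div]
    have h1 := one_div_Gamma_le hy hR0
    have hpow : R ^ (-(α * k + β)) = R ^ (-β) * (R ^ (-α)) ^ k := by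
      rw [← Real.rpow_natCast, ← Real.rpow_mul hR0.le, ← Real.rpow_add hR0]
      congr 1; ring
    have hXR : |x| * R ^ (-α) ≤ 1 / 2 := by
      calc |x| * R ^ (-α) ≤ X * R ^ (-a) := by
            refine mul_le_mul hx (Real.rpow_le_rpow_of_exponent_le hR1 (by linarith))
              (Real.rpow_nonneg hR0.le _) hX
        _ ≤ 1 / 2 := by
            rw [Real.rpow_neg hR0.le, hRa, ← div_eq_mul_inv, div_le_div_iff₀ (by linarith) two_pos]
            linarith
    have hαk : α * k + β ≤ k + β := by
      have := mul_le_mul_of_nonneg_right hα1 (k.cast_nonneg (α := ℝ))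
      linarith
    calc |x| ^ k * (1 / Real.Gamma (α * k + β))
        ≤ |x| ^ k * ((α * k + β) * Real.exp R * R ^ (-(α * k + β))) :=
          mul_le_mul_of_nonneg_left h1 (by positivity)
      _ = (α * k + β) * (Real.exp R * R ^ (-β) * (|x| * R ^ (-α)) ^ k) := by
          rw [hpow, mul_pow]; ring
      _ ≤ (k + β) * (Real.exp R * R ^ (-β) * (1 / 2) ^ k) := by
          have : 0 ≤ |x| * R ^ (-α) := by positivity
          gcongr
      _ = _ := by ring

section MittagLeffler

variable {α β : ℝ}

theorem summable_mittagLeffler (hα : 0 < α) (hα1 : α ≤ 1) (hβ : 0 < β) (x : ℝ) :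
    Summable fun k : ℕ => x ^ k / Real.Gamma (α * k + β) := by
  obtain ⟨b, hb, h⟩ := exists_mittagLeffler_majorant hα (abs_nonneg x) hβ
  exact hb.of_norm_bounded fun k => h k α x le_rfl hα1 le_rfl

theorem mittagLeffler_eq (hα : 0 < α) (hα1 : α ≤ 1) (hβ : 0 < β) (x : ℝ) :
    mittagLeffler α β x = 1 / Real.Gamma β + x * mittagLeffler α (α + β) x := by
  rw [mittagLeffler, (summable_mittagLeffler hα hα1 hβ x).tsum_eq_zero_add, mittagLeffler,
    ← tsum_mul_left]
  simp only [pow_zero, Nat.cast_zero, mul_zero, zero_add]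
  congr 1
  refine tsum_congr fun k => ?_
  rw [pow_succ', mul_div_assoc]
  congr 3
  push_cast; ring

theorem mittagLeffler_zero (hα : 0 < α) (hα1 : α ≤ 1) (hβ : 0 < β) :
    mittagLeffler α β 0 = 1 / Real.Gamma β := by
  rw [mittagLeffler_eq hα hα1 hβ, zero_mul, add_zero]

theorem continuous_mittagLeffler (hα : 0 < α) (hα1 : α ≤ 1) (hβ : 0 < β) :
    Continuous (mittagLeffler α β) := by
  refine continuous_iff_continuousAt.2 fun x₀ => ?_
  obtain ⟨b, hb, h⟩ := exists_mittagLeffler_majorant hα (by positivity : 0 ≤ |x₀| + 1) hβ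
  have hc : ContinuousOn (mittagLeffler α β) (Set.Icc (-(|x₀| + 1)) (|x₀| + 1)) := by
    refine continuousOn_tsum (fun k => by fun_prop) hb fun k x hx => ?_
    exact h k α x le_rfl hα1 (abs_le.2 hx)
  refine hc.continuousAt (Icc_mem_nhds ?_ ?_)
  · linarith [neg_abs_le x₀]
  · linarith [le_abs_self x₀]

theorem continuousOn_mittagLeffler_order (hβ : 0 < β) {f : ℝ → ℝ} (hf : Continuous f) :
    ContinuousOn (fun α => mittagLeffler α β (f α)) (Set.Ioc 0 1) := by
  intro α₀ hα₀
  obtain ⟨X, hX⟩ := (isCompact_Icc (a := α₀ / 2) (b := 1)).exists_bound_of_continuousOn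
    hf.continuousOn
  have hh : 0 < α₀ / 2 := half_pos hα₀.1
  have hX0 : 0 ≤ X := (norm_nonneg _).trans (hX α₀ ⟨by linarith, hα₀.2⟩)
  obtain ⟨b, hb, h⟩ := exists_mittagLeffler_majorant hh hX0 hβ
  have hc : ContinuousOn (fun α => mittagLeffler α β (f α)) (Set.Icc (α₀ / 2) 1) := by
    refine continuousOn_tsum (fun k => ?_) hb fun k α hα => h k α _ hα.1 hα.2 (hX α hα)
    intro α hα
    have hpos : 0 < α * k + β := by
      have : 0 ≤ α * k := mul_nonneg (by linarith [hα.1]) k.cast_nonneg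
      linarith
    refine ContinuousAt.continuousWithinAt ?_
    refine ContinuousAt.div (by fun_prop) ?_ (Real.Gamma_pos_of_pos hpos).ne'
    refine ContinuousAt.comp (g := Real.Gamma) ?_ (by fun_prop)
    refine (Real.differentiableAt_Gamma fun m => ?_).continuousAt
    have : (0 : ℝ) ≤ m := m.cast_nonneg
    linarith
  refine (hc α₀ ⟨by linarith, hα₀.2⟩).mono_of_mem_nhdsWithin ?_
  rw [mem_nhdsWithin]
  refine ⟨Set.Ioi (α₀ / 2), isOpen_Ioi, by simpa using hα₀.1, fun y hy => ⟨le_of_lt hy.1, hy.2.2⟩⟩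

/-- Riemann-Liouville integrals of Mittag-Leffler functions. -/
theorem integral_rpow_mul_mittagLeffler {γ t : ℝ} (hα : 0 < α) (hα1 : α ≤ 1) (hβ : 0 < β)
    (hγ : 0 < γ) (ht : 0 < t) (l : ℝ) :
    ∫ s in (0 : ℝ)..t, (t - s) ^ (γ - 1) * s ^ (β - 1) * mittagLeffler α β (-(l * s ^ α))
      = Real.Gamma γ * t ^ (γ + β - 1) * mittagLeffler α (γ + β) (-(l * t ^ α)) := by
  have hγG := Real.Gamma_pos_of_pos hγ
  have hk : ∀ k : ℕ, 0 < α * k + β := fun k => by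
    have : 0 ≤ α * k := mul_nonneg hα.le k.cast_nonneg
    linarith
  set F : ℕ → ℝ → ℝ := fun k s =>
    (-l) ^ k / Real.Gamma (α * k + β) * ((t - s) ^ (γ - 1) * s ^ (α * k + β - 1)) with hF
  have hFint : ∀ k, IntervalIntegrable (F k) volume 0 t := fun k =>
    (intervalIntegrable_sub_rpow_mul_rpow hγ (hk k) ht).const_mul _
  have hFval : ∀ k, ∫ s in (0 : ℝ)..t, F k s = Real.Gamma γ * t ^ (γ + β - 1) *
      ((-(l * t ^ α)) ^ k / Real.Gamma (α * k + (γ + β))) := by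
    intro k
    have hG := Real.Gamma_pos_of_pos (hk k)
    rw [intervalIntegral.integral_const_mul, integral_sub_rpow_mul_rpow hγ (hk k) ht,
      show γ + (α * k + β) = α * k + (γ + β) by ring,
      show α * k + (γ + β) - 1 = α * k + (γ + β - 1) by ring, Real.rpow_add ht, Real.rpow_mul ht.le,
      Real.rpow_natCast, ← neg_mul, mul_pow]
    field_simp
  -- The integrated norms are again Mittag-Leffler terms, now at `|l| * t ^ α`; their summability
  -- justifies exchanging sum and integral.
  have hFabs : ∀ k, ∫ s in Set.Ioc 0 t, ‖F k s‖ = Real.Gamma γ * t ^ (γ + β - 1) *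
      ((|l| * t ^ α) ^ k / Real.Gamma (α * k + (γ + β))) := by
    intro k
    have hG := Real.Gamma_pos_of_pos (hk k)
    have : ∀ s ∈ Set.Ioc 0 t, ‖F k s‖ = |l| ^ k / Real.Gamma (α * k + β) *
        ((t - s) ^ (γ - 1) * s ^ (α * k + β - 1)) := by
      intro s hs
      have h1 : 0 ≤ (t - s) ^ (γ - 1) := Real.rpow_nonneg (by linarith [hs.2]) _
      have h2 : 0 ≤ s ^ (α * k + β - 1) := Real.rpow_nonneg hs.1.le _
      rw [hF]
      simp only [norm_mul, norm_div, norm_pow, norm_neg, Real.norm_eq_abs, abs_of_nonneg h1,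
        abs_of_nonneg h2, abs_of_pos hG]
    rw [setIntegral_congr_fun measurableSet_Ioc this, ← intervalIntegral.integral_of_le ht.le,
      intervalIntegral.integral_const_mul, integral_sub_rpow_mul_rpow hγ (hk k) ht,
      show γ + (α * k + β) = α * k + (γ + β) by ring,
      show α * k + (γ + β) - 1 = α * k + (γ + β - 1) by ring, Real.rpow_add ht, Real.rpow_mul ht.le,
      Real.rpow_natCast, mul_pow]
    field_simp
  have hsum := hasSum_integral_of_summable_integral_norm
    (F := F) (μ := volume.restrict (Set.Ioc 0 t))
    (fun k => (intervalIntegrable_iff_integrableOn_Ioc_of_le ht.le).1 (hFint k)) (by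
      simp_rw [hFabs]
      exact (summable_mittagLeffler hα hα1 (by linarith) _).mul_left _)
  have hpt : ∀ s ∈ Set.Ioc 0 t, (∑' k, F k s) =
      (t - s) ^ (γ - 1) * s ^ (β - 1) * mittagLeffler α β (-(l * s ^ α)) := by
    intro s hs
    rw [mittagLeffler, ← tsum_mul_left]
    refine tsum_congr fun k => ?_
    rw [hF]
    simp only
    rw [show α * k + β - 1 = α * k + (β - 1) by ring, Real.rpow_add hs.1, Real.rpow_mul hs.1.le,
      Real.rpow_natCast, ← neg_mul, mul_pow]
    ring
  rw [setIntegral_congr_fun measurableSet_Ioc hpt] at hsum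
  rw [intervalIntegral.integral_of_le ht.le, ← hsum.tsum_eq, mittagLeffler, ← tsum_mul_left]
  refine tsum_congr fun k => ?_
  rw [← intervalIntegral.integral_of_le ht.le, hFval]

theorem intervalIntegrable_rpow_mul_mittagLeffler {γ t : ℝ} (hα : 0 < α) (hα1 : α ≤ 1)
    (hβ : 0 < β) (hγ : 0 < γ) (ht : 0 < t) (l : ℝ) :
    IntervalIntegrable
      (fun s => (t - s) ^ (γ - 1) * s ^ (β - 1) * mittagLeffler α β (-(l * s ^ α))) volume 0 t := by
  refine (intervalIntegrable_sub_rpow_mul_rpow hγ hβ ht).mul_continuousOn ?_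
  refine (continuous_mittagLeffler hα hα1 hβ).comp_continuousOn ?_
  exact (continuousOn_const.mul (Real.continuous_rpow_const hα.le).continuousOn).neg

end MittagLeffler

/-! ### Positivity and bounds for the Mittag-Leffler function on the negative half-line -/

section MittagLefflerBounds

variable {α : ℝ}

/-- A Volterra equation: split off the first term of the series and write the remainder, an
`E_{α,2α}`, as a Riemann-Liouville integral. The factor `t ^ (1 - α)` is kept inside because it
makes the kernel monotone in `t`. -/
theorem Gamma_mul_mittagLeffler_self_eq (hα : 0 < α) (hα1 : α ≤ 1) {t : ℝ} (ht : 0 < t) :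
    Real.Gamma α * mittagLeffler α α (-(1 * t ^ α)) = 1 - ∫ s in (0 : ℝ)..t,
      t ^ (1 - α) * ((t - s) ^ (α - 1) * s ^ (α - 1) * mittagLeffler α α (-(1 * s ^ α))) := by
  have hG := Real.Gamma_pos_of_pos hα
  rw [intervalIntegral.integral_const_mul, integral_rpow_mul_mittagLeffler hα hα1 hα hα ht,
    mittagLeffler_eq hα hα1 hα, mul_add, mul_one_div_cancel hG.ne']
  have : t ^ α = t ^ (1 - α) * t ^ (α + α - 1) := by
    rw [← Real.rpow_add ht]; congr 1; ring
  rw [one_mul, this]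
  ring

/-- The kernel equals `(s * (1 - s / t)) ^ (α - 1)`: the base grows with `t` and the exponent is
nonpositive. -/
theorem rpow_mul_sub_rpow_le_of_le (hα1 : α ≤ 1) {s t t' : ℝ} (hs : 0 < s) (hst : s < t)
    (htt : t ≤ t') :
    t' ^ (1 - α) * ((t' - s) ^ (α - 1) * s ^ (α - 1))
      ≤ t ^ (1 - α) * ((t - s) ^ (α - 1) * s ^ (α - 1)) := by
  have key : ∀ r : ℝ, s < r → r ^ (1 - α) * ((r - s) ^ (α - 1) * s ^ (α - 1))
      = (s * (1 - s / r)) ^ (α - 1) := by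
    intro r hr
    have hr0 : 0 < r := hs.trans hr
    have h1 : s * (1 - s / r) = (r - s) * s / r := by field_simp
    rw [h1, Real.div_rpow (mul_nonneg (by linarith) hs.le) hr0.le,
      Real.mul_rpow (by linarith) hs.le, show 1 - α = -(α - 1) by ring, Real.rpow_neg hr0.le]
    field_simp
  rw [key t' (by linarith), key t hst]
  have ht0 : 0 < t := hs.trans hst
  have hlt : s / t < 1 := (div_lt_one ht0).2 hst
  refine Real.rpow_le_rpow_of_nonpos (mul_pos hs (by linarith)) ?_ (by linarith)
  have : s / t' ≤ s / t := div_le_div_of_nonneg_left hs.le ht0 htt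
  nlinarith

/-- First-zero argument for the Volterra equation. Let `t₀` be the first point with `F ≤ 0` and `t <
t₀` close to it. Passing from `t` to `t₀` decreases the kernel on `(0, t)`, and the new piece over
`(t, t₀)` contributes less than `Γ(α) F(t)`; hence `F t₀ > 0`, a contradiction. -/
theorem mittagLeffler_self_nonneg (hα : 0 < α) (hα1 : α ≤ 1) {x : ℝ} (hx : 0 ≤ x) :
    0 ≤ mittagLeffler α α (-x) := by
  have hG := Real.Gamma_pos_of_pos hα
  set F : ℝ → ℝ := fun t => mittagLeffler α α (-(1 * t ^ α)) with hF
  have hFc : Continuous F := (continuous_mittagLeffler hα hα1 hα).comp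
    (continuous_const.mul (Real.continuous_rpow_const hα.le)).neg
  suffices h : ∀ t, 0 ≤ t → 0 ≤ F t by
    have := h (x ^ (1 / α)) (Real.rpow_nonneg hx _)
    simp only [hF] at this
    rwa [one_mul, ← Real.rpow_mul hx, one_div_mul_cancel hα.ne', Real.rpow_one] at this
  by_contra! hneg
  obtain ⟨t₂, ht₂, hFt₂⟩ := hneg
  set Z : Set ℝ := {t | 0 ≤ t ∧ F t ≤ 0} with hZ
  have hZc : IsClosed Z :=
    (isClosed_le continuous_const continuous_id).inter (isClosed_le hFc continuous_const)
  have hZb : BddBelow Z := ⟨0, fun t ht => ht.1⟩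
  obtain ⟨h0, hFt0⟩ : sInf Z ∈ Z := hZc.csInf_mem ⟨t₂, ht₂, hFt₂.le⟩ hZb
  set t₀ := sInf Z with ht₀
  have hF0 : 0 < F 0 := by
    simp only [hF, Real.zero_rpow hα.ne', mul_zero, neg_zero, mittagLeffler_zero hα hα1 hα]
    positivity
  have ht₀pos : 0 < t₀ := by
    rcases h0.eq_or_lt with h | h
    · rw [← h] at hFt0; linarith
    · exact h
  have hFpos : ∀ t, 0 ≤ t → t < t₀ → 0 < F t := by
    intro t ht htt
    by_contra! h
    exact absurd (csInf_le hZb (show t ∈ Z from ⟨ht, h⟩)) (not_le.2 htt)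
  set K : ℝ → ℝ → ℝ := fun t s => t ^ (1 - α) * ((t - s) ^ (α - 1) * s ^ (α - 1)) with hK
  have hKint : ∀ t, 0 < t → IntervalIntegrable (K t) volume 0 t := fun t ht =>
    (intervalIntegrable_sub_rpow_mul_rpow hα hα ht).const_mul _
  have hKF : ∀ t, 0 < t → IntervalIntegrable (fun s => K t s * F s) volume 0 t := fun t ht =>
    (hKint t ht).mul_continuousOn hFc.continuousOn
  have heq : ∀ t, 0 < t → Real.Gamma α * F t = 1 - ∫ s in (0 : ℝ)..t, K t s * F s := by
    intro t ht
    rw [Gamma_mul_mittagLeffler_self_eq hα hα1 ht]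
    simp only [hK, mul_assoc]
    rfl
  -- The kernel is integrable up to its singularity at `t₀`, so its mass near `t₀` can be made
  -- smaller than `Γ(α)`.
  obtain ⟨t₁, ht₁pos, ht₁, hsmall⟩ : ∃ t₁, 0 < t₁ ∧ t₁ < t₀ ∧
      ∀ t ∈ Set.Icc t₁ t₀, ∫ s in t..t₀, K t₀ s < Real.Gamma α := by
    have hc := intervalIntegral.continuousOn_primitive_interval' (hKint t₀ ht₀pos)
      (a := t₀) Set.right_mem_uIcc
    rw [Set.uIcc_of_le ht₀pos.le] at hc
    have hc0 := hc t₀ ⟨ht₀pos.le, le_rfl⟩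
    rw [ContinuousWithinAt, intervalIntegral.integral_same] at hc0
    have hev := hc0.eventually (lt_mem_nhds (neg_lt_zero.2 hG))
    rw [nhdsWithin_Icc_eq_nhdsLE ht₀pos, eventually_iff] at hev
    obtain ⟨l, hl, hlsub⟩ := mem_nhdsLE_iff_exists_Icc_subset.1 hev
    refine ⟨max l (t₀ / 2), lt_max_of_lt_right (half_pos ht₀pos),
      max_lt hl (half_lt_self ht₀pos), fun t ht => ?_⟩
    have := hlsub ⟨(le_max_left _ _).trans ht.1, ht.2⟩
    rw [Set.mem_ofPred_eq, intervalIntegral.integral_symm] at this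
    linarith
  -- Taking `t` as a maximum point of `F` on `[t₁, t₀]` gives `F s ≤ F t` throughout `(t, t₀)`.
  obtain ⟨t, htmem, htmax⟩ := isCompact_Icc.exists_isMaxOn (Set.nonempty_Icc.2 ht₁.le)
    (hFc.continuousOn (s := Set.Icc t₁ t₀))
  have hFtpos : 0 < F t :=
    (hFpos t₁ ht₁pos.le ht₁).trans_le (htmax (Set.left_mem_Icc.2 ht₁.le))
  have htlt : t < t₀ := by
    rcases htmem.2.eq_or_lt with h | h
    · rw [h] at hFtpos; linarith
    · exact h
  have htpos : 0 < t := ht₁pos.trans_le htmem.1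
  have hsubL : Set.uIcc 0 t ⊆ Set.uIcc 0 t₀ := by
    rw [Set.uIcc_of_le htpos.le, Set.uIcc_of_le ht₀pos.le]; exact Set.Icc_subset_Icc le_rfl htlt.le
  have hsubR : Set.uIcc t t₀ ⊆ Set.uIcc 0 t₀ := by
    rw [Set.uIcc_of_le htlt.le, Set.uIcc_of_le ht₀pos.le]; exact Set.Icc_subset_Icc htpos.le le_rfl
  have hsplit := intervalIntegral.integral_add_adjacent_intervals
    ((hKF t₀ ht₀pos).mono_set hsubL) ((hKF t₀ ht₀pos).mono_set hsubR)
  have hle1 : ∫ s in (0 : ℝ)..t, K t₀ s * F s ≤ ∫ s in (0 : ℝ)..t, K t s * F s := by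
    refine intervalIntegral.integral_mono_on_of_le_Ioo htpos.le ((hKF t₀ ht₀pos).mono_set hsubL)
      (hKF t htpos) fun s hs => ?_
    exact mul_le_mul_of_nonneg_right (rpow_mul_sub_rpow_le_of_le hα1 hs.1 hs.2 htlt.le)
      (hFpos s hs.1.le (hs.2.trans htlt)).le
  have hle2 : ∫ s in t..t₀, K t₀ s * F s ≤ (∫ s in t..t₀, K t₀ s) * F t := by
    rw [← intervalIntegral.integral_mul_const]
    refine intervalIntegral.integral_mono_on_of_le_Ioo htlt.le ((hKF t₀ ht₀pos).mono_set hsubR)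
      (((hKint t₀ ht₀pos).mono_set hsubR).mul_const _) fun s hs => ?_
    have h1 : 0 < s := htpos.trans hs.1
    refine mul_le_mul_of_nonneg_left (htmax ⟨htmem.1.trans hs.1.le, hs.2.le⟩) ?_
    exact mul_nonneg (Real.rpow_nonneg ht₀pos.le _)
      (mul_nonneg (Real.rpow_nonneg (by linarith [hs.2]) _) (Real.rpow_nonneg h1.le _))
  have e1 := heq t htpos
  have e2 := heq t₀ ht₀pos
  have h3 := hsmall t htmem
  nlinarith [mul_lt_mul_of_pos_right h3 hFtpos, mul_nonneg hG.le (neg_nonneg.2 hFt0)]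


theorem mittagLeffler_one_eq (hα : 0 < α) (hα1 : α ≤ 1) (x : ℝ) :
    mittagLeffler α 1 x = 1 + x * mittagLeffler α (α + 1) x := by
  rw [mittagLeffler_eq hα hα1 one_pos, Real.Gamma_one, div_one]

theorem continuous_mittagLeffler_neg_mul_rpow {β : ℝ} (hα : 0 < α) (hα1 : α ≤ 1) (hβ : 0 < β)
    (l : ℝ) : Continuous fun t : ℝ => mittagLeffler α β (-(l * t ^ α)) :=
  (continuous_mittagLeffler hα hα1 hβ).comp
    (continuous_const.mul (Real.continuous_rpow_const hα.le)).neg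

theorem intervalIntegrable_rpow_mul_mittagLeffler_self (hα : 0 < α) (hα1 : α ≤ 1) (a b : ℝ) :
    IntervalIntegrable (fun s => s ^ (α - 1) * mittagLeffler α α (-(1 * s ^ α))) volume a b :=
  (intervalIntegral.intervalIntegrable_rpow' (by linarith)).mul_continuousOn
    (continuous_mittagLeffler_neg_mul_rpow hα hα1 hα 1).continuousOn

theorem integral_rpow_mul_mittagLeffler_self (hα : 0 < α) (hα1 : α ≤ 1) {t : ℝ} (ht : 0 ≤ t) :
    ∫ s in (0 : ℝ)..t, s ^ (α - 1) * mittagLeffler α α (-(1 * s ^ α))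
      = 1 - mittagLeffler α 1 (-(1 * t ^ α)) := by
  rcases ht.eq_or_lt with rfl | ht
  · rw [intervalIntegral.integral_same, Real.zero_rpow hα.ne', mul_zero, neg_zero,
      mittagLeffler_zero hα hα1 one_pos, Real.Gamma_one]
    norm_num
  · have h := integral_rpow_mul_mittagLeffler hα hα1 hα one_pos ht 1
    simp only [sub_self, Real.rpow_zero, one_mul, Real.Gamma_one] at h
    rw [mittagLeffler_one_eq hα hα1]
    simp only [one_mul]
    rw [h, add_comm α 1, add_sub_cancel_left]
    ring

theorem antitoneOn_mittagLeffler_one_rpow (hα : 0 < α) (hα1 : α ≤ 1) :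
    AntitoneOn (fun t : ℝ => mittagLeffler α 1 (-(1 * t ^ α))) (Set.Ici 0) := by
  intro t ht t' ht' htt
  have h1 := integral_rpow_mul_mittagLeffler_self hα hα1 ht
  have h2 := integral_rpow_mul_mittagLeffler_self hα hα1 ht'
  have h3 := intervalIntegral.integral_add_adjacent_intervals
    (intervalIntegrable_rpow_mul_mittagLeffler_self hα hα1 0 t)
    (intervalIntegrable_rpow_mul_mittagLeffler_self hα hα1 t t')
  have h4 : 0 ≤ ∫ s in t..t', s ^ (α - 1) * mittagLeffler α α (-(1 * s ^ α)) := by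
    refine intervalIntegral.integral_nonneg htt fun s hs => ?_
    have hs0 : 0 ≤ s := le_trans ht hs.1
    rw [one_mul]
    exact mul_nonneg (Real.rpow_nonneg hs0 _)
      (mittagLeffler_self_nonneg hα hα1 (Real.rpow_nonneg hs0 _))
  simp only
  linarith

/-- Substitution `x = t ^ α`; the factor `1 *` matches the shape `l * t ^ α` of the integral
identities. -/
theorem eq_rpow_of_nonneg (hα : 0 < α) {x : ℝ} (hx : 0 ≤ x) :
    0 ≤ x ^ (1 / α) ∧ x = 1 * (x ^ (1 / α)) ^ α := by
  refine ⟨Real.rpow_nonneg hx _, ?_⟩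
  rw [one_mul, ← Real.rpow_mul hx, one_div_mul_cancel hα.ne', Real.rpow_one]

theorem mittagLeffler_one_zero (hα : 0 < α) (hα1 : α ≤ 1) : mittagLeffler α 1 0 = 1 := by
  rw [mittagLeffler_zero hα hα1 one_pos, Real.Gamma_one, div_one]

theorem mittagLeffler_one_le_one (hα : 0 < α) (hα1 : α ≤ 1) {x : ℝ} (hx : 0 ≤ x) :
    mittagLeffler α 1 (-x) ≤ 1 := by
  obtain ⟨h0, h⟩ := eq_rpow_of_nonneg hα hx
  have := antitoneOn_mittagLeffler_one_rpow hα hα1 (Set.mem_Ici.2 le_rfl) (Set.mem_Ici.2 h0) h0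
  simp only [Real.zero_rpow hα.ne', mul_zero, neg_zero, mittagLeffler_one_zero hα hα1] at this
  rwa [h]

/-- With `x = t ^ α`, the integral of order `1 - α` of `s ^ (α - 1) E_{α,α}(-s^α)` is `Γ(1 - α)
E_{α,1}(-x)`. Bounding its kernel below by `t ^ (-α)` leaves `(1 - E_{α,1}(-x)) / x`. -/
theorem one_le_mul_mittagLeffler_one (hα : 0 < α) (hα1 : α < 1) {x : ℝ} (hx : 0 ≤ x) :
    1 ≤ (1 + Real.Gamma (1 - α) * x) * mittagLeffler α 1 (-x) := by
  rcases hx.eq_or_lt with rfl | hx'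
  · rw [neg_zero, mittagLeffler_one_zero hα hα1.le]; norm_num
  have ht : 0 < x ^ (1 / α) := Real.rpow_pos_of_pos hx' _
  obtain ⟨h0, h⟩ := eq_rpow_of_nonneg hα hx
  set t := x ^ (1 / α)
  have hγ : 0 < 1 - α := by linarith
  have e1 := integral_rpow_mul_mittagLeffler hα hα1.le hα hγ ht 1
  have e2 := integral_rpow_mul_mittagLeffler_self hα hα1.le h0
  have hle : t ^ (-α) * ∫ s in (0 : ℝ)..t, s ^ (α - 1) * mittagLeffler α α (-(1 * s ^ α))
      ≤ ∫ s in (0 : ℝ)..t, (t - s) ^ (1 - α - 1) * s ^ (α - 1) *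
        mittagLeffler α α (-(1 * s ^ α)) := by
    rw [← intervalIntegral.integral_const_mul]
    refine intervalIntegral.integral_mono_on_of_le_Ioo h0
      ((intervalIntegrable_rpow_mul_mittagLeffler_self hα hα1.le 0 t).const_mul _)
      (intervalIntegrable_rpow_mul_mittagLeffler hα hα1.le hα hγ ht 1) fun s hs => ?_
    rw [mul_assoc, show 1 - α - 1 = -α by ring]
    refine mul_le_mul_of_nonneg_right
      (Real.rpow_le_rpow_of_nonpos (by linarith [hs.2]) (by linarith [hs.1]) (by linarith)) ?_
    rw [one_mul]
    exact mul_nonneg (Real.rpow_nonneg hs.1.le _)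
      (mittagLeffler_self_nonneg hα hα1.le (Real.rpow_nonneg hs.1.le _))
  rw [e1, e2, show 1 - α + α = 1 by ring, sub_self, Real.rpow_zero, ← h, Real.rpow_neg h0,
    show t ^ α = x by rw [← one_mul (t ^ α)]; exact h.symm, mul_one,
    inv_mul_le_iff₀ hx'] at hle
  linarith

theorem mittagLeffler_one_pos (hα : 0 < α) (hα1 : α < 1) {x : ℝ} (hx : 0 ≤ x) :
    0 < mittagLeffler α 1 (-x) := by
  have h := one_le_mul_mittagLeffler_one hα hα1 hx
  have hG := Real.Gamma_pos_of_pos (show 0 < 1 - α by linarith)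
  have : 0 < 1 + Real.Gamma (1 - α) * x := by positivity
  by_contra! h'
  nlinarith

theorem one_div_mittagLeffler_one_le (hα : 0 < α) (hα1 : α < 1) {x : ℝ} (hx : 0 ≤ x) :
    1 / mittagLeffler α 1 (-x) ≤ 1 + Real.Gamma (1 - α) * x := by
  rw [div_le_iff₀ (mittagLeffler_one_pos hα hα1 hx)]
  exact one_le_mul_mittagLeffler_one hα hα1 hx

/-- The order-`α` integral of the decreasing function `E_{α,1}(-s^α)` equals `Γ(α) (1 -
E_{α,1}(-x))`; replace the integrand by its value at the right endpoint. -/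
theorem mul_mittagLeffler_one_le_one (hα : 0 < α) (hα1 : α ≤ 1) {x : ℝ} (hx : 0 ≤ x) :
    (1 + x / Real.Gamma (α + 1)) * mittagLeffler α 1 (-x) ≤ 1 := by
  rcases hx.eq_or_lt with rfl | hx'
  · rw [neg_zero, mittagLeffler_one_zero hα hα1]; norm_num
  have ht : 0 < x ^ (1 / α) := Real.rpow_pos_of_pos hx' _
  obtain ⟨h0, h⟩ := eq_rpow_of_nonneg hα hx
  set t := x ^ (1 / α)
  have htx : t ^ α = x := by rw [← one_mul (t ^ α)]; exact h.symm
  have e1 := integral_rpow_mul_mittagLeffler hα hα1 one_pos hα ht 1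
  have e3 := integral_sub_rpow_mul_rpow hα one_pos ht
  have hle : (∫ s in (0 : ℝ)..t, (t - s) ^ (α - 1) * s ^ ((1 : ℝ) - 1)) * mittagLeffler α 1 (-x)
      ≤ ∫ s in (0 : ℝ)..t, (t - s) ^ (α - 1) * s ^ ((1 : ℝ) - 1) *
        mittagLeffler α 1 (-(1 * s ^ α)) := by
    rw [← intervalIntegral.integral_mul_const]
    refine intervalIntegral.integral_mono_on_of_le_Ioo h0
      ((intervalIntegrable_sub_rpow_mul_rpow hα one_pos ht).mul_const _)
      (intervalIntegrable_rpow_mul_mittagLeffler hα hα1 one_pos hα ht 1) fun s hs => ?_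
    refine mul_le_mul_of_nonneg_left ?_
      (mul_nonneg (Real.rpow_nonneg (by linarith [hs.2]) _) (Real.rpow_nonneg hs.1.le _))
    rw [h]
    exact antitoneOn_mittagLeffler_one_rpow hα hα1 (Set.mem_Ici.2 hs.1.le) (Set.mem_Ici.2 h0)
      hs.2.le
  have hrec := mittagLeffler_one_eq hα hα1 (-x)
  have hG := Real.Gamma_pos_of_pos hα
  rw [e1, e3, Real.Gamma_one, mul_one, add_sub_cancel_right, htx, one_mul,
    Real.Gamma_add_one hα.ne'] at hle
  rw [Real.Gamma_add_one hα.ne']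
  have h5 : Real.Gamma α * x * mittagLeffler α (α + 1) (-x)
      = Real.Gamma α * (1 - mittagLeffler α 1 (-x)) := by rw [hrec]; ring
  rw [h5, mul_assoc] at hle
  have h6 := le_of_mul_le_mul_left (a := Real.Gamma α)
    (b := 1 / (α * Real.Gamma α) * (x * mittagLeffler α 1 (-x))) (by
      refine le_trans (le_of_eq ?_) hle
      field_simp) hG
  have : x / (α * Real.Gamma α) * mittagLeffler α 1 (-x)
      = 1 / (α * Real.Gamma α) * (x * mittagLeffler α 1 (-x)) := by ring
  linarith

/-- Bound `(t - s) ^ (α - 1)` below by `t ^ (α - 1)` in the Volterra equation. This controls the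
logarithmic derivative of `E_{α,1}(-t^α)`. -/
theorem Gamma_mul_mittagLeffler_self_le (hα : 0 < α) (hα1 : α ≤ 1) {t : ℝ} (ht : 0 < t) :
    Real.Gamma α * mittagLeffler α α (-(1 * t ^ α)) ≤ mittagLeffler α 1 (-(1 * t ^ α)) := by
  have e2 := integral_rpow_mul_mittagLeffler_self hα hα1 ht.le
  rw [Gamma_mul_mittagLeffler_self_eq hα hα1 ht, intervalIntegral.integral_const_mul]
  have hle : t ^ (α - 1) * ∫ s in (0 : ℝ)..t, s ^ (α - 1) * mittagLeffler α α (-(1 * s ^ α))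
      ≤ ∫ s in (0 : ℝ)..t, (t - s) ^ (α - 1) * s ^ (α - 1) *
        mittagLeffler α α (-(1 * s ^ α)) := by
    rw [← intervalIntegral.integral_const_mul]
    refine intervalIntegral.integral_mono_on_of_le_Ioo ht.le
      ((intervalIntegrable_rpow_mul_mittagLeffler_self hα hα1 0 t).const_mul _)
      (intervalIntegrable_rpow_mul_mittagLeffler hα hα1 hα hα ht 1) fun s hs => ?_
    rw [mul_assoc]
    refine mul_le_mul_of_nonneg_right
      (Real.rpow_le_rpow_of_nonpos (by linarith [hs.2]) (by linarith [hs.1]) (by linarith)) ?_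
    rw [one_mul]
    exact mul_nonneg (Real.rpow_nonneg hs.1.le _)
      (mittagLeffler_self_nonneg hα hα1 (Real.rpow_nonneg hs.1.le _))
  have h7 := mul_le_mul_of_nonneg_left hle (Real.rpow_nonneg ht.le (1 - α))
  rw [← mul_assoc, ← Real.rpow_add ht, show 1 - α + (α - 1) = 0 by ring, Real.rpow_zero, one_mul,
    e2] at h7
  linarith

theorem hasDerivAt_mittagLeffler_one_rpow (hα : 0 < α) (hα1 : α ≤ 1) {t : ℝ} (ht : 0 < t) :
    HasDerivAt (fun t : ℝ => mittagLeffler α 1 (-(1 * t ^ α)))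
      (-(t ^ (α - 1) * mittagLeffler α α (-(1 * t ^ α)))) t := by
  have hcont : ContinuousAt (fun s => s ^ (α - 1) * mittagLeffler α α (-(1 * s ^ α))) t :=
    (Real.continuousAt_rpow_const _ _ (Or.inl ht.ne')).mul
      (continuous_mittagLeffler_neg_mul_rpow hα hα1 hα 1).continuousAt
  have hmeas : Measurable (fun s : ℝ => s ^ (α - 1) * mittagLeffler α α (-(1 * s ^ α))) :=
    (Measurable.pow_const measurable_id _).mul
      (continuous_mittagLeffler_neg_mul_rpow hα hα1 hα 1).measurable
  have h := intervalIntegral.integral_hasDerivAt_right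
    (intervalIntegrable_rpow_mul_mittagLeffler_self hα hα1 0 t)
    hmeas.stronglyMeasurable.stronglyMeasurableAtFilter hcont
  refine (h.const_sub 1).congr_of_eventuallyEq ?_
  filter_upwards [lt_mem_nhds ht] with r hr
  rw [integral_rpow_mul_mittagLeffler_self hα hα1 hr.le]
  ring

/-- The quotient of the two sides is monotone in `t = x ^ (1 / α)` and equals `1` at `0`. This bound
remains useful as `α → 1`, where the algebraic one degenerates because `Γ(1 - α)` blows up. -/
theorem exp_neg_div_Gamma_le_mittagLeffler_one (hα : 0 < α) (hα1 : α ≤ 1) {x : ℝ} (hx : 0 ≤ x) :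
    Real.exp (-(x / Real.Gamma (α + 1))) ≤ mittagLeffler α 1 (-x) := by
  obtain ⟨h0, h⟩ := eq_rpow_of_nonneg hα hx
  set t := x ^ (1 / α)
  have hG := Real.Gamma_pos_of_pos hα
  set w : ℝ → ℝ := fun r => mittagLeffler α 1 (-(1 * r ^ α)) *
    Real.exp (r ^ α / Real.Gamma (α + 1)) with hw
  have hmono : MonotoneOn w (Set.Ici 0) := by
    refine monotoneOn_of_hasDerivWithinAt_nonneg (convex_Ici 0)
      (f' := fun r => -(r ^ (α - 1) * mittagLeffler α α (-(1 * r ^ α))) *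
        Real.exp (r ^ α / Real.Gamma (α + 1)) + mittagLeffler α 1 (-(1 * r ^ α)) *
        (Real.exp (r ^ α / Real.Gamma (α + 1)) * (α * r ^ (α - 1) / Real.Gamma (α + 1)))) ?_ ?_ ?_
    · refine ((continuous_mittagLeffler_neg_mul_rpow hα hα1 one_pos 1).mul ?_).continuousOn
      exact Real.continuous_exp.comp ((Real.continuous_rpow_const hα.le).div_const _)
    · intro r hr
      rw [interior_Ici] at hr
      have hr0 : 0 < r := hr
      exact ((hasDerivAt_mittagLeffler_one_rpow hα hα1 hr0).mul
        ((Real.hasDerivAt_rpow_const (Or.inl hr0.ne')).div_const _).exp).hasDerivWithinAt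
    · intro r hr
      rw [interior_Ici] at hr
      have hr0 : 0 < r := hr
      have h1 := Gamma_mul_mittagLeffler_self_le hα hα1 hr0
      have h2 : 0 ≤ r ^ (α - 1) * Real.exp (r ^ α / Real.Gamma (α + 1)) / Real.Gamma α := by
        have := Real.rpow_pos_of_pos hr0 (α - 1)
        positivity
      have h3 := mul_le_mul_of_nonneg_left h1 h2
      have h4 : α * r ^ (α - 1) / Real.Gamma (α + 1) = r ^ (α - 1) / Real.Gamma α := by
        rw [Real.Gamma_add_one hα.ne']; field_simp
      rw [h4]
      refine (sub_nonneg.2 h3).trans_eq ?_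
      field_simp
      ring
  have h8 := hmono (Set.mem_Ici.2 le_rfl) (Set.mem_Ici.2 h0) h0
  simp only [hw, Real.zero_rpow hα.ne', mul_zero, neg_zero, zero_div, Real.exp_zero,
    mittagLeffler_one_zero hα hα1, mul_one] at h8
  rw [← h, show t ^ α = x by rw [← one_mul (t ^ α)]; exact h.symm] at h8
  rw [Real.exp_neg]
  exact (inv_le_iff_one_le_mul₀ (Real.exp_pos _)).2 h8

end MittagLefflerBounds

/-! ### Comparison of the Mittag-Leffler function with the exponential -/

section Comparison

variable {α l T : ℝ}

theorem rpow_le_mul_add (hα : 0 < α) (hα1 : α ≤ 1) {t : ℝ} (ht : 0 ≤ t) :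
    t ^ α ≤ α * t + (1 - α) := by
  have := Real.geom_mean_le_arith_mean2_weighted hα.le (sub_nonneg.2 hα1) ht zero_le_one
    (by ring)
  simpa using this

/-- Compares the fractional kernel with the constant kernel. The right-hand side integrates in
closed form, and its integral over `(0, t)` is `O(1 - α)`. -/
theorem abs_one_sub_rpow_div_Gamma_le (hα : 1 / 2 ≤ α) (hα1 : α ≤ 1) {r : ℝ} (hr : 0 < r) :
    |1 - r ^ (α - 1) / Real.Gamma α|
      ≤ (1 + 2 * (1 - α)) * r ^ (α - 1) - 1 + 2 * (1 - α) * r := by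
  have hr' := Real.rpow_pos_of_pos hr (α - 1)
  have hG1 := one_le_Gamma (x := α) (by linarith) hα1
  have hG2 := Gamma_sub_one_le hα hα1
  have hG0 : 0 < Real.Gamma α := by linarith
  have hlog : 1 - (1 - α) * r ≤ r ^ (α - 1) := by
    rw [Real.rpow_def_of_pos hr]
    have h1 := Real.add_one_le_exp (Real.log r * (α - 1))
    have h2 := Real.log_le_sub_one_of_pos hr
    nlinarith
  have hinv1 : r ^ (α - 1) / Real.Gamma α ≤ r ^ (α - 1) := div_le_self hr'.le hG1
  have hinv2 : r ^ (α - 1) - r ^ (α - 1) / Real.Gamma α ≤ 2 * (1 - α) * r ^ (α - 1) := by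
    have h3 : 1 - 1 / Real.Gamma α ≤ 2 * (1 - α) := by
      rw [one_sub_div hG0.ne', div_le_iff₀ hG0]
      nlinarith
    calc _ = r ^ (α - 1) * (1 - 1 / Real.Gamma α) := by ring
      _ ≤ r ^ (α - 1) * (2 * (1 - α)) := mul_le_mul_of_nonneg_left h3 hr'.le
      _ = _ := by ring
  rw [abs_le]
  constructor <;> nlinarith

/-- The second term is the order-`α` integral of the integrand of the first. Since `0 ≤ E_{α,1} ≤
1`, only the kernel difference matters and the bound is independent of `l`. -/
theorem integral_sub_integral_rpow_mul_le (hα : 1 / 2 ≤ α) (hα1 : α < 1) (hl : 0 ≤ l) {t : ℝ}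
    (ht : 0 < t) :
    |(∫ s in (0 : ℝ)..t, mittagLeffler α 1 (-(l * s ^ α)))
      - t ^ α * mittagLeffler α (α + 1) (-(l * t ^ α))| ≤ (1 - α) * (4 + 2 * t + t ^ 2) := by
  have hα0 : 0 < α := by linarith
  have hG0 := Real.Gamma_pos_of_pos hα0
  have hcont := continuous_mittagLeffler_neg_mul_rpow hα0 hα1.le one_pos l
  have e1 := integral_rpow_mul_mittagLeffler hα0 hα1.le one_pos hα0 ht l
  have i1 := intervalIntegrable_rpow_mul_mittagLeffler hα0 hα1.le one_pos hα0 ht l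
  simp only [sub_self, Real.rpow_zero, mul_one] at e1 i1
  rw [add_sub_cancel_right] at e1
  have e2 : t ^ α * mittagLeffler α (α + 1) (-(l * t ^ α)) = ∫ s in (0 : ℝ)..t,
      1 / Real.Gamma α * ((t - s) ^ (α - 1) * mittagLeffler α 1 (-(l * s ^ α))) := by
    rw [intervalIntegral.integral_const_mul, e1]; field_simp
  rw [e2, ← intervalIntegral.integral_sub (hcont.intervalIntegrable 0 t) (i1.const_mul _)]
  set g : ℝ → ℝ := fun r => (1 + 2 * (1 - α)) * r ^ (α - 1) - 1 + 2 * (1 - α) * r with hg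
  have ir : IntervalIntegrable (fun r : ℝ => r ^ (α - 1)) volume 0 t :=
    intervalIntegral.intervalIntegrable_rpow' (by linarith)
  have i2 : IntervalIntegrable (fun r : ℝ => (1 + 2 * (1 - α)) * r ^ (α - 1) - 1) volume 0 t :=
    (ir.const_mul _).sub intervalIntegrable_const
  have i3 : IntervalIntegrable (fun r : ℝ => 2 * (1 - α) * r) volume 0 t :=
    (by fun_prop : Continuous fun r : ℝ => 2 * (1 - α) * r).intervalIntegrable 0 t
  have ig : IntervalIntegrable g volume 0 t := i2.add i3
  have ig' : IntervalIntegrable (fun s => g (t - s)) volume 0 t := by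
    have := (ig.comp_sub_left t).symm
    simpa using this
  have hgval : ∫ s in (0 : ℝ)..t, g (t - s)
      = (1 + 2 * (1 - α)) * (t ^ α / α) - t + (1 - α) * t ^ 2 := by
    rw [intervalIntegral.integral_comp_sub_left g t, sub_self, sub_zero]
    simp only [hg]
    rw [intervalIntegral.integral_add i2 i3,
      intervalIntegral.integral_sub (ir.const_mul _) intervalIntegrable_const,
      intervalIntegral.integral_const_mul, intervalIntegral.integral_const_mul, integral_id,
      integral_rpow (Or.inl (by linarith)), intervalIntegral.integral_const,
      show α - 1 + 1 = α by ring, Real.zero_rpow hα0.ne']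
    simp only [smul_eq_mul]
    ring
  have hbound : ‖∫ s in (0 : ℝ)..t, (mittagLeffler α 1 (-(l * s ^ α)) -
      1 / Real.Gamma α * ((t - s) ^ (α - 1) * mittagLeffler α 1 (-(l * s ^ α))))‖
      ≤ ∫ s in (0 : ℝ)..t, g (t - s) := by
    refine intervalIntegral.norm_integral_le_of_norm_le ht.le ?_ ig'
    have hne : ∀ᵐ s : ℝ, s ≠ t := by
      simp [ae_iff]
    filter_upwards [hne] with s hst hs
    have hx : 0 ≤ l * s ^ α := mul_nonneg hl (Real.rpow_nonneg hs.1.le _)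
    have hu0 := (mittagLeffler_one_pos hα0 hα1 hx).le
    have hu1 := mittagLeffler_one_le_one hα0 hα1.le hx
    have hlt : 0 < t - s := sub_pos.2 (lt_of_le_of_ne hs.2 hst)
    have h := abs_one_sub_rpow_div_Gamma_le hα hα1.le hlt
    rw [show mittagLeffler α 1 (-(l * s ^ α)) -
      1 / Real.Gamma α * ((t - s) ^ (α - 1) * mittagLeffler α 1 (-(l * s ^ α)))
      = (1 - (t - s) ^ (α - 1) / Real.Gamma α) * mittagLeffler α 1 (-(l * s ^ α)) by ring,
      norm_mul, Real.norm_eq_abs, Real.norm_of_nonneg hu0]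
    exact (mul_le_of_le_one_right (abs_nonneg _) hu1).trans h
  rw [Real.norm_eq_abs, hgval] at hbound
  refine hbound.trans ?_
  have h1 : t ^ α / α ≤ t + 2 * (1 - α) := by
    rw [div_le_iff₀ hα0]
    have := rpow_le_mul_add hα0 hα1.le ht.le
    nlinarith
  have h2 : 0 ≤ 1 - α := by linarith
  have h3 := mul_le_mul_of_nonneg_left h1 (show 0 ≤ 1 + 2 * (1 - α) by linarith)
  nlinarith

/-- `u = E_{α,1}(-l t^α)` solves `u = 1 - l I^α u`. Replacing `I^α` by the ordinary integral `U`
leaves a defect `R` with `|R| ≤ ε`, hence a perturbed linear equation for `U` and a Gronwall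
estimate. -/
theorem abs_mittagLeffler_sub_exp_le_of_half_le (hα : 1 / 2 ≤ α) (hα1 : α < 1) (hl : 0 ≤ l)
    (hT : 0 < T) :
    |mittagLeffler α 1 (-(l * T ^ α)) - Real.exp (-l * T)|
      ≤ 2 * l * ((1 - α) * (4 + 2 * T + T ^ 2)) := by
  have hα0 : 0 < α := by linarith
  set ε := (1 - α) * (4 + 2 * T + T ^ 2) with hε
  have hε0 : 0 ≤ ε := mul_nonneg (by linarith) (by positivity)
  set u : ℝ → ℝ := fun s => mittagLeffler α 1 (-(l * s ^ α)) with hu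
  have hucont : Continuous u := continuous_mittagLeffler_neg_mul_rpow hα0 hα1.le one_pos l
  set U : ℝ → ℝ := fun t => ∫ s in (0 : ℝ)..t, u s with hU
  set R : ℝ → ℝ := fun t => U t - t ^ α * mittagLeffler α (α + 1) (-(l * t ^ α)) with hR
  have hUd : ∀ t, HasDerivAt U (u t) t := fun t =>
    intervalIntegral.integral_hasDerivAt_right (hucont.intervalIntegrable _ _)
      hucont.stronglyMeasurable.stronglyMeasurableAtFilter hucont.continuousAt
  have hu' : ∀ t, u t = 1 - l * U t + l * R t := by
    intro t
    simp only [hR, hu]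
    rw [mittagLeffler_one_eq hα0 hα1.le]
    ring
  have hRle : ∀ t, 0 < t → t ≤ T → |R t| ≤ ε := by
    intro t ht htT
    refine (integral_sub_integral_rpow_mul_le hα hα1 hl ht).trans ?_
    refine mul_le_mul_of_nonneg_left ?_ (by linarith)
    have : t ^ 2 ≤ T ^ 2 := pow_le_pow_left₀ ht.le htT 2
    linarith
  set Y : ℝ → ℝ := fun t => l * U t - (1 - Real.exp (-l * t)) with hY
  have hY0 : Y 0 = 0 := by simp [hY, hU]
  have hYd : ∀ t, HasDerivAt Y (-l * Y t + l ^ 2 * R t) t := by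
    intro t
    have h1 : HasDerivAt (fun t => Real.exp (-l * t)) (Real.exp (-l * t) * -l) t := by
      simpa using ((hasDerivAt_id t).const_mul (-l)).exp
    refine (((hUd t).const_mul l).sub (h1.const_sub 1)).congr_deriv ?_
    rw [hu' t]
    simp only [hY]
    ring
  -- Integrating factor for `Y' = -l Y + l² R`; the choices `c = ± l ε` give the derivative a fixed
  -- sign.
  have hPd : ∀ c t, HasDerivAt (fun t => Real.exp (l * t) * (Y t - c))
      (Real.exp (l * t) * (l * (l * R t - c))) t := by
    intro c t
    have h1 : HasDerivAt (fun t => Real.exp (l * t)) (Real.exp (l * t) * l) t := by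
      simpa using ((hasDerivAt_id t).const_mul l).exp
    refine (h1.mul ((hYd t).sub_const c)).congr_deriv ?_
    ring
  have h0T : (0 : ℝ) ∈ Set.Icc 0 T := ⟨le_rfl, hT.le⟩
  have hTT : T ∈ Set.Icc 0 T := ⟨hT.le, le_rfl⟩
  have hup : Y T ≤ l * ε := by
    have hanti : AntitoneOn (fun t => Real.exp (l * t) * (Y t - l * ε)) (Set.Icc 0 T) := by
      refine antitoneOn_of_hasDerivWithinAt_nonpos (convex_Icc 0 T)
        (fun t _ => (hPd (l * ε) t).continuousAt.continuousWithinAt)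
        (fun t _ => (hPd (l * ε) t).hasDerivWithinAt) fun t ht => ?_
      rw [interior_Icc] at ht
      have := (abs_le.1 (hRle t ht.1 ht.2.le)).2
      exact mul_nonpos_of_nonneg_of_nonpos (Real.exp_pos _).le
        (mul_nonpos_of_nonneg_of_nonpos hl (by nlinarith))
    have := hanti h0T hTT hT.le
    simp only [hY0, mul_zero, Real.exp_zero, zero_sub, one_mul] at this
    by_contra! h
    have h5 : 0 < Real.exp (l * T) * (Y T - l * ε) := mul_pos (Real.exp_pos _) (by linarith)
    nlinarith
  have hlow : -(l * ε) ≤ Y T := by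
    have hmono : MonotoneOn (fun t => Real.exp (l * t) * (Y t - -(l * ε))) (Set.Icc 0 T) := by
      refine monotoneOn_of_hasDerivWithinAt_nonneg (convex_Icc 0 T)
        (fun t _ => (hPd _ t).continuousAt.continuousWithinAt)
        (fun t _ => (hPd _ t).hasDerivWithinAt) fun t ht => ?_
      rw [interior_Icc] at ht
      have := (abs_le.1 (hRle t ht.1 ht.2.le)).1
      exact mul_nonneg (Real.exp_pos _).le (mul_nonneg hl (by nlinarith))
    have := hmono h0T hTT hT.le
    simp only [hY0, mul_zero, Real.exp_zero, zero_sub, one_mul] at this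
    by_contra! h
    have h5 : Real.exp (l * T) * (Y T - -(l * ε)) < 0 :=
      mul_neg_of_pos_of_neg (Real.exp_pos _) (by linarith)
    nlinarith
  have hfin : u T - Real.exp (-l * T) = -Y T + l * R T := by
    rw [hu' T]; simp only [hY]; ring
  have hRT := abs_le.1 (hRle T hT le_rfl)
  change |u T - _| ≤ _
  rw [hfin, abs_le]
  constructor <;> nlinarith

theorem abs_mittagLeffler_sub_exp_le (hα : 0 < α) (hα1 : α < 1) (hl : 0 ≤ l) (hT : 0 < T) :
    |mittagLeffler α 1 (-(l * T ^ α)) - Real.exp (-l * T)|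
      ≤ 2 * (4 + 2 * T + T ^ 2) * (1 - α) * (1 + l) := by
  have h1 : 0 < 1 - α := by linarith
  rcases le_or_gt (1 / 2) α with h | h
  · refine (abs_mittagLeffler_sub_exp_le_of_half_le h hα1 hl hT).trans ?_
    have : 0 ≤ 2 * (4 + 2 * T + T ^ 2) * (1 - α) := by positivity
    linarith
  -- Away from `α = 1` the bound is trivial: both quantities lie in `[0, 1]` and the right-hand side
  -- is at least `1`.
  · have hx : 0 ≤ l * T ^ α := mul_nonneg hl (Real.rpow_nonneg hT.le _)
    have a1 := mittagLeffler_one_pos hα hα1 hx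
    have a2 := mittagLeffler_one_le_one hα hα1.le hx
    have b1 := Real.exp_pos (-l * T)
    have b2 : Real.exp (-l * T) ≤ 1 := Real.exp_le_one_iff.2 (by nlinarith)
    have h3 : (1 : ℝ) ≤ 2 * (4 + 2 * T + T ^ 2) * (1 - α) * (1 + l) := by
      have : 1 ≤ 2 * (4 + 2 * T + T ^ 2) * (1 - α) := by nlinarith [sq_nonneg T]
      nlinarith
    refine le_trans ?_ h3
    rw [abs_le]
    constructor <;> linarith

theorem mul_exp_neg_le {y : ℝ} : y * Real.exp (-y) ≤ 1 := by
  rw [Real.exp_neg, ← div_eq_mul_inv, div_le_one (Real.exp_pos _)]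
  linarith [Real.add_one_le_exp y]

theorem sq_mul_exp_neg_le {y : ℝ} (hy : 0 ≤ y) : y ^ 2 * Real.exp (-y) ≤ 2 := by
  rw [Real.exp_neg, ← div_eq_mul_inv, div_le_iff₀ (Real.exp_pos _)]
  linarith [Real.quadratic_le_exp_of_nonneg hy]

/-- Two regimes. If `α ≥ 1 / 2` and `l (1 - α) ≤ 1`, the exponential lower bound loses at most `e^{2
l (1 - α)} ≤ e^2`. Otherwise `1 / (1 - α) ≤ 2 + l`, so the algebraic bound is quadratic in `l` and
`e^{-lT}` absorbs it. -/
theorem exists_exp_div_mittagLeffler_le (hT : 0 < T) :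
    ∃ C, 0 < C ∧ ∀ α l : ℝ, 0 < α → α < 1 → 0 ≤ l →
      Real.exp (-l * T) * (1 / mittagLeffler α 1 (-(l * T ^ α))) ≤ C := by
  refine ⟨Real.exp 2 + (1 + (1 + T) * (2 / T + 2 / T ^ 2)), by positivity,
    fun α l hα hα1 hl => ?_⟩
  have hTα := Real.rpow_nonneg hT.le α
  have hx : 0 ≤ l * T ^ α := mul_nonneg hl hTα
  have hTle := rpow_le_mul_add hα hα1.le hT.le
  have hE := Real.exp_pos (-l * T)
  have hη : 0 < 1 - α := by linarith
  by_cases hcase : 1 / 2 ≤ α ∧ l * (1 - α) ≤ 1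
  · obtain ⟨hα2, hlη⟩ := hcase
    have h1 := exp_neg_div_Gamma_le_mittagLeffler_one hα hα1.le hx
    have hG := le_Gamma_add_one hα hα1.le
    have h2 : T ^ α / Real.Gamma (α + 1) ≤ T + 2 * (1 - α) := by
      refine (div_le_div_of_nonneg_left hTα hα hG).trans ?_
      rw [div_le_iff₀ hα]
      nlinarith
    have h3 : 1 / mittagLeffler α 1 (-(l * T ^ α)) ≤ Real.exp (l * T ^ α / Real.Gamma (α + 1)) := by
      rw [div_le_iff₀ (mittagLeffler_one_pos hα hα1 hx)]
      calc 1 = Real.exp (l * T ^ α / Real.Gamma (α + 1)) *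
            Real.exp (-(l * T ^ α / Real.Gamma (α + 1))) := by
            rw [← Real.exp_add, add_neg_cancel, Real.exp_zero]
        _ ≤ _ := mul_le_mul_of_nonneg_left h1 (Real.exp_pos _).le
    have h4 : Real.exp (-l * T) * (1 / mittagLeffler α 1 (-(l * T ^ α))) ≤ Real.exp 2 := by
      refine (mul_le_mul_of_nonneg_left h3 hE.le).trans ?_
      rw [← Real.exp_add, Real.exp_le_exp, mul_div_assoc]
      have := mul_le_mul_of_nonneg_left h2 hl
      nlinarith
    have : 0 ≤ 1 + (1 + T) * (2 / T + 2 / T ^ 2) := by positivity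
    linarith
  · have h1 : 1 / (1 - α) ≤ 2 + l := by
      rw [div_le_iff₀ hη]
      by_cases h : 1 / 2 ≤ α
      · have : 1 < l * (1 - α) := by
          by_contra! h'
          exact hcase ⟨h, h'⟩
        nlinarith
      · push Not at h
        nlinarith
    have h2 := one_div_mittagLeffler_one_le hα hα1 hx
    have h3 : Real.Gamma (1 - α) ≤ 2 + l := (Gamma_one_sub_le hα hα1).trans h1
    have h4 : T ^ α ≤ 1 + T := by nlinarith
    have h5 : Real.Gamma (1 - α) * (l * T ^ α) ≤ (2 + l) * (l * (1 + T)) :=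
      mul_le_mul h3 (mul_le_mul_of_nonneg_left h4 hl) hx (by linarith)
    have h6 : Real.exp (-l * T) * (1 / mittagLeffler α 1 (-(l * T ^ α)))
        ≤ Real.exp (-l * T) * (1 + (2 + l) * (l * (1 + T))) :=
      mul_le_mul_of_nonneg_left (h2.trans (by linarith)) hE.le
    have h7 : l * Real.exp (-l * T) ≤ 1 / T := by
      rw [le_div_iff₀ hT]
      have := mul_exp_neg_le (y := l * T)
      rw [neg_mul]; linarith
    have h8 : l ^ 2 * Real.exp (-l * T) ≤ 2 / T ^ 2 := by
      rw [le_div_iff₀ (by positivity)]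
      have := sq_mul_exp_neg_le (y := l * T) (by positivity)
      rw [neg_mul]; nlinarith
    have h9 : Real.exp (-l * T) ≤ 1 := Real.exp_le_one_iff.2 (by nlinarith)
    have h10 : Real.exp (-l * T) * (1 + (2 + l) * (l * (1 + T)))
        = Real.exp (-l * T) + (1 + T) * (2 * (l * Real.exp (-l * T))
          + l ^ 2 * Real.exp (-l * T)) := by ring
    have h11 : (1 + T) * (2 * (l * Real.exp (-l * T)) + l ^ 2 * Real.exp (-l * T))
        ≤ (1 + T) * (2 / T + 2 / T ^ 2) := by
      refine mul_le_mul_of_nonneg_left ?_ (by linarith)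
      have : 2 / T = 2 * (1 / T) := by ring
      linarith
    have := Real.exp_pos 2
    linarith

end Comparison

/-! ### The amplification factors -/

section AmpFrac

variable {lam : ℕ → ℝ} {T α : ℝ}

theorem ampFrac_pos (hlam : ∀ k, 0 < lam k) (hT : 0 < T) (hα : 0 < α) (hα1 : α < 1) (k : ℕ) :
    0 < ampFrac lam T α k :=
  one_div_pos.2 (mittagLeffler_one_pos hα hα1
    (mul_nonneg (hlam k).le (Real.rpow_nonneg hT.le _)))

theorem ampFrac_le (hlam : ∀ k, 0 < lam k) (hT : 0 < T) (hα : 0 < α) (hα1 : α < 1) (k : ℕ) :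
    ampFrac lam T α k ≤ 1 + (1 + T) * (1 / (1 - α)) * lam k := by
  have hx : 0 ≤ lam k * T ^ α := mul_nonneg (hlam k).le (Real.rpow_nonneg hT.le _)
  have h1 := one_div_mittagLeffler_one_le hα hα1 hx
  have h2 := Gamma_one_sub_le hα hα1
  have h3 := rpow_le_mul_add hα hα1.le hT.le
  have h4 : T ^ α ≤ 1 + T := by nlinarith
  have h5 : Real.Gamma (1 - α) * (lam k * T ^ α) ≤ (1 / (1 - α)) * (lam k * (1 + T)) :=
    mul_le_mul h2 (mul_le_mul_of_nonneg_left h4 (hlam k).le) hx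
      (one_div_nonneg.2 (by linarith))
  refine h1.trans ?_
  linarith

/-- `|e / E - 1| e = (e / E) |E - e|`: the spare factor `e` carried by exact data trades division by
`E` for the uniform constant `C`. -/
theorem abs_exp_mul_ampFrac_sub_one_mul_exp_le (hlam : ∀ k, 0 < lam k) (hT : 0 < T) {C : ℝ}
    (hα : 0 < α) (hα1 : α < 1) (k : ℕ)
    (hC : Real.exp (-lam k * T) * ampFrac lam T α k ≤ C) :
    |Real.exp (-lam k * T) * ampFrac lam T α k - 1| * Real.exp (-lam k * T)
      ≤ C * (2 * (4 + 2 * T + T ^ 2) * (1 - α) * (1 + lam k)) := by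
  have hx : 0 ≤ lam k * T ^ α := mul_nonneg (hlam k).le (Real.rpow_nonneg hT.le _)
  have hE := mittagLeffler_one_pos hα hα1 hx
  have hamp := ampFrac_pos hlam hT hα hα1 k
  have h1 := abs_mittagLeffler_sub_exp_le hα hα1 (hlam k).le hT
  have h0 : 0 ≤ Real.exp (-lam k * T) * ampFrac lam T α k :=
    mul_nonneg (Real.exp_pos _).le hamp.le
  have h2 : |Real.exp (-lam k * T) * ampFrac lam T α k - 1| * Real.exp (-lam k * T)
      = Real.exp (-lam k * T) * ampFrac lam T α k *
        |mittagLeffler α 1 (-(lam k * T ^ α)) - Real.exp (-lam k * T)| := by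
    have h3 : Real.exp (-lam k * T) * ampFrac lam T α k - 1
        = -(ampFrac lam T α k *
          (mittagLeffler α 1 (-(lam k * T ^ α)) - Real.exp (-lam k * T))) := by
      rw [ampFrac, mul_sub, one_div_mul_cancel hE.ne']; ring
    rw [h3, abs_neg, abs_mul, abs_of_pos hamp]
    ring
  rw [h2]
  exact mul_le_mul hC h1 (abs_nonneg _) (h0.trans hC)

theorem continuousOn_ampFrac (hlam : ∀ k, 0 < lam k) (hT : 0 < T) (k : ℕ) :
    ContinuousOn (fun α => ampFrac lam T α k) (Set.Ioo 0 1) := by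
  refine ContinuousOn.div continuousOn_const ?_ fun α hα => ?_
  · refine (continuousOn_mittagLeffler_order one_pos ?_).mono Set.Ioo_subset_Ioc_self
    exact (continuous_const.mul (Real.continuous_const_rpow hT.ne')).neg
  · exact (mittagLeffler_one_pos hα.1 hα.2
      (mul_nonneg (hlam k).le (Real.rpow_nonneg hT.le _))).ne'

/-- Squeezed between the two algebraic bounds, which have the same limit because `Γ(1) = 1`. -/
theorem tendsto_ampFrac_zero (hlam : ∀ k, 0 < lam k) (hT : 0 < T) (k : ℕ) :
    Tendsto (fun α => ampFrac lam T α k) (𝓝[Set.Ioo 0 1] 0) (𝓝 (1 + lam k)) := by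
  have hG : ContinuousAt Real.Gamma 1 :=
    (Real.differentiableAt_Gamma fun m => by have : (0 : ℝ) ≤ m := m.cast_nonneg
                                             linarith).continuousAt
  have hTc : ContinuousAt (fun α : ℝ => T ^ α) 0 := Real.continuousAt_const_rpow hT.ne'
  have h1 : Tendsto (fun α : ℝ => 1 + Real.Gamma (1 - α) * (lam k * T ^ α)) (𝓝 0)
      (𝓝 (1 + lam k)) := by
    have hg : ContinuousAt (fun α : ℝ => Real.Gamma (1 - α)) 0 :=
      ContinuousAt.comp (g := Real.Gamma) (by simpa using hG) (by fun_prop)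
    have : ContinuousAt (fun α : ℝ => 1 + Real.Gamma (1 - α) * (lam k * T ^ α)) 0 :=
      continuousAt_const.add (hg.mul (continuousAt_const.mul hTc))
    have h := this.tendsto
    simpa using h
  have h2 : Tendsto (fun α : ℝ => 1 + lam k * T ^ α / Real.Gamma (α + 1)) (𝓝 0)
      (𝓝 (1 + lam k)) := by
    have hg : ContinuousAt (fun α : ℝ => Real.Gamma (α + 1)) 0 :=
      ContinuousAt.comp (g := Real.Gamma) (by simpa using hG) (by fun_prop)
    have : ContinuousAt (fun α : ℝ => 1 + lam k * T ^ α / Real.Gamma (α + 1)) 0 :=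
      continuousAt_const.add ((continuousAt_const.mul hTc).div hg (by simp))
    have h := this.tendsto
    simpa using h
  refine tendsto_of_tendsto_of_tendsto_of_le_of_le' (h2.mono_left nhdsWithin_le_nhds)
    (h1.mono_left nhdsWithin_le_nhds) ?_ ?_
  · filter_upwards [self_mem_nhdsWithin] with α hα
    have hx : 0 ≤ lam k * T ^ α := mul_nonneg (hlam k).le (Real.rpow_nonneg hT.le _)
    rw [ampFrac, le_div_iff₀ (mittagLeffler_one_pos hα.1 hα.2 hx)]
    exact mul_mittagLeffler_one_le_one hα.1 hα.2.le hx
  · filter_upwards [self_mem_nhdsWithin] with α hα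
    exact one_div_mittagLeffler_one_le hα.1 hα.2
      (mul_nonneg (hlam k).le (Real.rpow_nonneg hT.le _))

theorem tendsto_exp_mul_ampFrac_one (hlam : ∀ k, 0 < lam k) (hT : 0 < T) (k : ℕ) :
    Tendsto (fun α => Real.exp (-lam k * T) * ampFrac lam T α k - 1) (𝓝[Set.Ioo 0 1] 1)
      (𝓝 0) := by
  obtain ⟨C, -, hC⟩ := exists_exp_div_mittagLeffler_le hT
  have hE := Real.exp_pos (-lam k * T)
  have hlim : Tendsto (fun α : ℝ => C * (2 * (4 + 2 * T + T ^ 2) * (1 - α) * (1 + lam k)) /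
      Real.exp (-lam k * T)) (𝓝[Set.Ioo 0 1] 1) (𝓝 0) := by
    have : ContinuousAt (fun α : ℝ => C * (2 * (4 + 2 * T + T ^ 2) * (1 - α) * (1 + lam k)) /
      Real.exp (-lam k * T)) 1 := by fun_prop
    have h := this.tendsto.mono_left (nhdsWithin_le_nhds (s := Set.Ioo (0 : ℝ) 1))
    simpa using h
  refine squeeze_zero_norm' ?_ hlim
  filter_upwards [self_mem_nhdsWithin] with α hα
  rw [Real.norm_eq_abs, le_div_iff₀ hE]
  exact abs_exp_mul_ampFrac_sub_one_mul_exp_le hlam hT hα.1 hα.2 k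
    (hC α (lam k) hα.1 hα.2 (hlam k).le)

end AmpFrac

/-! ### Spectral multipliers -/

section SpectralCalculus

variable {H : Type*} [NormedAddCommGroup H] [InnerProductSpace ℝ H] (φ : HilbertBasis ℕ ℝ H)

theorem HilbertBasis.hasSum_sq_inner (x : H) : HasSum (fun k => ⟪φ k, x⟫ ^ 2) (‖x‖ ^ 2) := by
  have h := φ.hasSum_inner_mul_inner x x
  rw [real_inner_self_eq_norm_sq] at h
  refine h.congr_fun fun k => ?_
  rw [real_inner_comm, sq]

theorem HilbertBasis.hasSum_of_summable_sq {c : ℕ → ℝ} (hc : Summable fun k => c k ^ 2) :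
    ∃ x, HasSum (fun k => c k • φ k) x ∧ ∀ k, ⟪φ k, x⟫ = c k := by
  have hmem : Memℓp c 2 := by
    refine memℓp_gen ?_
    simpa using hc
  refine ⟨φ.repr.symm ⟨c, hmem⟩, φ.hasSum_repr_symm ⟨c, hmem⟩, fun k => ?_⟩
  rw [← φ.repr_apply_apply, LinearIsometryEquiv.apply_symm_apply]

theorem HilbertBasis.norm_le_of_abs_inner_le {x y : H} (h : ∀ k, |⟪φ k, x⟫| ≤ |⟪φ k, y⟫|) :
    ‖x‖ ≤ ‖y‖ :=
  (sq_le_sq₀ (norm_nonneg x) (norm_nonneg y)).1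
    (hasSum_le (fun k => sq_le_sq.2 (h k)) (φ.hasSum_sq_inner x) (φ.hasSum_sq_inner y))

theorem HilbertBasis.exists_abs_inner (y : H) :
    ∃ z, ‖z‖ = ‖y‖ ∧ ∀ k, ⟪φ k, z⟫ = |⟪φ k, y⟫| := by
  obtain ⟨z, -, hz⟩ := φ.hasSum_of_summable_sq (c := fun k => |⟪φ k, y⟫|)
    (by simpa using (φ.hasSum_sq_inner y).summable)
  refine ⟨z, le_antisymm ?_ ?_, hz⟩ <;>
  · refine φ.norm_le_of_abs_inner_le fun k => ?_
    rw [hz, abs_abs]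

/-- Minkowski's inequality: replacing coefficients by their absolute values keeps norms, and then
the triangle inequality in `H` applies. -/
theorem HilbertBasis.norm_le_add_of_abs_inner_le {x y z : H} {A B : ℝ} (hA : 0 ≤ A) (hB : 0 ≤ B)
    (h : ∀ k, |⟪φ k, x⟫| ≤ A * |⟪φ k, y⟫| + B * |⟪φ k, z⟫|) :
    ‖x‖ ≤ A * ‖y‖ + B * ‖z‖ := by
  obtain ⟨y', hy', hyk⟩ := φ.exists_abs_inner y
  obtain ⟨z', hz', hzk⟩ := φ.exists_abs_inner z
  have h1 : ‖x‖ ≤ ‖A • y' + B • z'‖ := φ.norm_le_of_abs_inner_le fun k => by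
    rw [inner_add_right, inner_smul_right, inner_smul_right, hyk, hzk]
    exact (h k).trans (le_abs_self _)
  refine h1.trans ((norm_add_le _ _).trans ?_)
  rw [norm_smul, norm_smul, hy', hz', Real.norm_of_nonneg hA, Real.norm_of_nonneg hB]

theorem summable_sq_mul_inner {m : ℕ → ℝ} {C : ℝ} (hm : ∀ k, |m k| ≤ C) (v : H) :
    Summable fun k => (m k * ⟪φ k, v⟫) ^ 2 := by
  refine Summable.of_nonneg_of_le (fun k => sq_nonneg _) (fun k => ?_)
    ((φ.hasSum_sq_inner v).summable.mul_left (C ^ 2))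
  rw [mul_pow]
  exact mul_le_mul_of_nonneg_right
    (sq_le_sq' (by linarith [abs_le.1 (hm k)]) (abs_le.1 (hm k)).2) (sq_nonneg _)

theorem inner_specMul {m : ℕ → ℝ} {v : H} (h : Summable fun k => (m k * ⟪φ k, v⟫) ^ 2) (k : ℕ) :
    ⟪φ k, specMul φ m v⟫ = m k * ⟪φ k, v⟫ := by
  obtain ⟨x, hx, hxk⟩ := φ.hasSum_of_summable_sq h
  rw [specMul, hx.tsum_eq, hxk]

/-- A bounded sequence whose coefficients converge converges weakly. -/
theorem HilbertBasis.tendsto_inner_of_tendsto_coeff {ι : Type*} {l : Filter ι} {u : ι → H} {x : H}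
    {B : ℝ} (hB : ∀ᶠ n in l, ‖u n‖ ≤ B)
    (hc : ∀ k, Tendsto (fun n => ⟪φ k, u n⟫) l (𝓝 ⟪φ k, x⟫)) (v : H) :
    Tendsto (fun n => ⟪u n, v⟫) l (𝓝 ⟪x, v⟫) := by
  have hspan : ∀ w ∈ Submodule.span ℝ (Set.range φ),
      Tendsto (fun n => ⟪u n, w⟫) l (𝓝 ⟪x, w⟫) := by
    intro w hw
    induction hw using Submodule.span_induction with
    | mem w hw =>
      obtain ⟨k, rfl⟩ := hw
      simpa only [real_inner_comm] using hc k
    | zero => simpa using tendsto_const_nhds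
    | add w w' _ _ h h' => simpa only [inner_add_right] using h.add h'
    | smul c w _ h => simpa only [inner_smul_right] using h.const_mul c
  rw [Metric.tendsto_nhds]
  intro ε hε
  have hden : 0 < |B| + ‖x‖ + 1 := by positivity
  have hv : v ∈ closure (Submodule.span ℝ (Set.range φ) : Set H) := by
    rw [← Submodule.topologicalClosure_coe, φ.dense_span]; trivial
  obtain ⟨w, hw, hvw⟩ := Metric.mem_closure_iff.1 hv (ε / 2 / (|B| + ‖x‖ + 1)) (by positivity)
  filter_upwards [hB, Metric.tendsto_nhds.1 (hspan w hw) (ε / 2) (half_pos hε)] with n hn hnw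
  rw [Real.dist_eq, ← inner_sub_left] at hnw ⊢
  have h1 : ⟪u n - x, v⟫ = ⟪u n - x, w⟫ + ⟪u n - x, v - w⟫ := by
    rw [← inner_add_right, add_sub_cancel]
  have h2 : |⟪u n - x, v - w⟫| ≤ (|B| + ‖x‖ + 1) * ‖v - w‖ := by
    refine (abs_real_inner_le_norm _ _).trans (mul_le_mul_of_nonneg_right ?_ (norm_nonneg _))
    have := norm_sub_le (u n) x
    linarith [le_abs_self B]
  have h3 : (|B| + ‖x‖ + 1) * ‖v - w‖ < ε / 2 := by
    rw [dist_eq_norm, lt_div_iff₀ hden] at hvw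
    linarith
  rw [h1]
  have := abs_add_le ⟪u n - x, w⟫ ⟪u n - x, v - w⟫
  linarith

end SpectralCalculus

/-! ### Landweber iteration -/

section Landweber

variable {H : Type*} [NormedAddCommGroup H] [InnerProductSpace ℝ H] {φ : HilbertBasis ℕ ℝ H}
  {lam : ℕ → ℝ} {s μ : ℝ}

/-- The filter function `1 - (1 - μ λ_k^(-2s))^i` of Landweber iteration. -/
noncomputable def landweberFilter (lam : ℕ → ℝ) (s μ : ℝ) (i k : ℕ) : ℝ :=
  1 - (1 - μ * lam k ^ (-(2 * s))) ^ i

theorem inner_smoothingOp (hlam : ∀ k, 0 < lam k) (hmono : Monotone lam) (hs : 0 ≤ s) (v : H)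
    (k : ℕ) : ⟪φ k, smoothingOp φ lam s μ v⟫ = μ * lam k ^ (-(2 * s)) * ⟪φ k, v⟫ := by
  have hb : ∀ k, |lam k ^ (-(2 * s))| ≤ lam 0 ^ (-(2 * s)) := fun k => by
    rw [abs_of_pos (Real.rpow_pos_of_pos (hlam k) _)]
    exact Real.rpow_le_rpow_of_nonpos (hlam 0) (hmono k.zero_le) (by linarith)
  rw [smoothingOp, inner_smul_right, inner_specMul φ (summable_sq_mul_inner φ hb v), mul_assoc]

theorem mul_rpow_le_one_of_norm_smoothingOp_le (hlam : ∀ k, 0 < lam k) (hmono : Monotone lam)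
    (hs : 0 ≤ s) (hA : ∀ v, ‖smoothingOp φ lam s μ v‖ ≤ ‖v‖) (k : ℕ) :
    μ * lam k ^ (-(2 * s)) ≤ 1 := by
  have h1 := inner_smoothingOp (φ := φ) (μ := μ) hlam hmono hs (φ k) k
  have h2 : ‖φ k‖ = 1 := φ.orthonormal.1 k
  rw [real_inner_self_eq_norm_sq, h2, one_pow, mul_one] at h1
  rw [← h1]
  refine (real_inner_le_norm _ _).trans ?_
  rw [h2, one_mul, ← h2]
  exact hA _

theorem inner_landweber (hlam : ∀ k, 0 < lam k) (hmono : Monotone lam) (hs : 0 ≤ s) (gδ : H)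
    (i k : ℕ) :
    ⟪φ k, landweber φ lam s μ gδ i⟫ = landweberFilter lam s μ i k * ⟪φ k, gδ⟫ := by
  induction i with
  | zero => simp [landweber, landweberFilter]
  | succ i ih =>
    rw [landweber, inner_sub_right, inner_smoothingOp hlam hmono hs, inner_sub_right, ih,
      landweberFilter, landweberFilter, pow_succ]
    ring

theorem landweberFilter_mem_Icc (hlam : ∀ k, 0 < lam k) (hμ : 0 < μ)
    (hθ : ∀ k, μ * lam k ^ (-(2 * s)) ≤ 1) (i k : ℕ) :
    landweberFilter lam s μ i k ∈ Set.Icc 0 1 := by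
  have h0 : 0 < μ * lam k ^ (-(2 * s)) := mul_pos hμ (Real.rpow_pos_of_pos (hlam k) _)
  have h1 : 0 ≤ 1 - μ * lam k ^ (-(2 * s)) := by linarith [hθ k]
  have h2 := pow_nonneg h1 i
  have h3 := pow_le_one₀ (n := i) h1 (by linarith)
  constructor <;> rw [landweberFilter] <;> linarith

/-- Multiply the bounds `q ≤ 1` and `q ≤ i μ λ^{-2s}` (Bernoulli) to get `(λ q)² ≤ i μ λ^{2-2s}`; `s
≥ 1` moves the last power to the smallest eigenvalue. The growth `√i` is what the noise level can
compensate. -/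
theorem mul_landweberFilter_le (hlam : ∀ k, 0 < lam k) (hμ : 0 < μ)
    (hθ : ∀ k, μ * lam k ^ (-(2 * s)) ≤ 1) (hmono : Monotone lam) (hs : 1 ≤ s) (i k : ℕ) :
    lam k * landweberFilter lam s μ i k ≤ √(i * (μ * lam 0 ^ (2 - 2 * s))) := by
  obtain ⟨q0, q1⟩ := landweberFilter_mem_Icc hlam hμ hθ i k
  have hb : landweberFilter lam s μ i k ≤ i * (μ * lam k ^ (-(2 * s))) := by
    have := one_add_mul_le_pow (a := -(μ * lam k ^ (-(2 * s)))) (by linarith [hθ k]) i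
    rw [landweberFilter, sub_eq_add_neg 1 (μ * _)]
    linarith
  have hpow : lam k ^ 2 * lam k ^ (-(2 * s)) = lam k ^ (2 - 2 * s) := by
    rw [← Real.rpow_natCast, ← Real.rpow_add (hlam k)]
    congr 1
  have hle : lam k ^ (2 - 2 * s) ≤ lam 0 ^ (2 - 2 * s) :=
    Real.rpow_le_rpow_of_nonpos (hlam 0) (hmono k.zero_le) (by linarith)
  refine Real.le_sqrt_of_sq_le ?_
  calc (lam k * landweberFilter lam s μ i k) ^ 2
      = lam k ^ 2 * (landweberFilter lam s μ i k * landweberFilter lam s μ i k) := by ring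
    _ ≤ lam k ^ 2 * (i * (μ * lam k ^ (-(2 * s)))) := by
        refine mul_le_mul_of_nonneg_left ?_ (sq_nonneg _)
        exact (mul_le_of_le_one_right q0 q1).trans hb
    _ = i * (μ * (lam k ^ 2 * lam k ^ (-(2 * s)))) := by ring
    _ ≤ i * (μ * lam 0 ^ (2 - 2 * s)) := by
        rw [hpow]
        gcongr

theorem tendsto_landweberFilter (hlam : ∀ k, 0 < lam k) (hμ : 0 < μ)
    (hθ : ∀ k, μ * lam k ^ (-(2 * s)) ≤ 1) {i : ℕ → ℕ}
    (hi : Tendsto i atTop atTop) (k : ℕ) :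
    Tendsto (fun n => landweberFilter lam s μ (i n) k) atTop (𝓝 1) := by
  have h0 : 0 < μ * lam k ^ (-(2 * s)) := mul_pos hμ (Real.rpow_pos_of_pos (hlam k) _)
  have h := (tendsto_pow_atTop_nhds_zero_of_lt_one
    (r := 1 - μ * lam k ^ (-(2 * s))) (by linarith [hθ k]) (by linarith)).comp hi
  simpa [landweberFilter, Function.comp_def] using h.const_sub 1

end Landweber

/-! ### The regularized reconstruction -/

section Reconstruction

variable {H : Type*} [NormedAddCommGroup H] [InnerProductSpace ℝ H] {φ : HilbertBasis ℕ ℝ H}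
  {lam : ℕ → ℝ} {s μ T α : ℝ}

theorem inner_heatSemigroup (hlam : ∀ k, 0 < lam k) (hT : 0 < T) (v : H) (k : ℕ) :
    ⟪φ k, heatSemigroup φ lam T v⟫ = Real.exp (-lam k * T) * ⟪φ k, v⟫ := by
  refine inner_specMul φ (summable_sq_mul_inner φ (C := 1) (fun k => ?_) v) k
  rw [abs_of_pos (Real.exp_pos _), Real.exp_le_one_iff]
  nlinarith [hlam k]

theorem ampFrac_mul_landweberFilter_le (hlam : ∀ k, 0 < lam k) (hμ : 0 < μ)
    (hθ : ∀ k, μ * lam k ^ (-(2 * s)) ≤ 1) (hmono : Monotone lam) (hs : 1 ≤ s) (hT : 0 < T)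
    (hα : 0 < α) (hα1 : α < 1) (i k : ℕ) :
    ampFrac lam T α k * landweberFilter lam s μ i k
      ≤ 1 + (1 + T) * (1 / (1 - α)) * √(i * (μ * lam 0 ^ (2 - 2 * s))) := by
  obtain ⟨q0, q1⟩ := landweberFilter_mem_Icc hlam hμ hθ i k
  have h1 := mul_le_mul_of_nonneg_right (ampFrac_le hlam hT hα hα1 k) q0
  have h2 := mul_landweberFilter_le hlam hμ hθ hmono hs i k
  have h3 : 0 ≤ (1 + T) * (1 / (1 - α)) :=
    mul_nonneg (by linarith) (one_div_nonneg.2 (by linarith))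
  have h4 := mul_le_mul_of_nonneg_left h2 h3
  nlinarith

theorem summable_sq_ampFrac_mul_inner_landweber (hlam : ∀ k, 0 < lam k) (hμ : 0 < μ)
    (hθ : ∀ k, μ * lam k ^ (-(2 * s)) ≤ 1) (hmono : Monotone lam) (hs : 1 ≤ s) (hT : 0 < T)
    (hα : 0 < α) (hα1 : α < 1) (gδ : H) (i : ℕ) :
    Summable fun k => (ampFrac lam T α k * ⟪φ k, landweber φ lam s μ gδ i⟫) ^ 2 := by
  have h := summable_sq_mul_inner φ (m := fun k => ampFrac lam T α k * landweberFilter lam s μ i k)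
    (fun k => by
      rw [abs_of_nonneg (mul_nonneg (ampFrac_pos hlam hT hα hα1 k).le
        (landweberFilter_mem_Icc hlam hμ hθ i k).1)]
      exact ampFrac_mul_landweberFilter_le hlam hμ hθ hmono hs hT hα hα1 i k) gδ
  refine h.congr fun k => ?_
  rw [inner_landweber hlam hmono (by linarith), mul_assoc]

theorem inner_heatSemigroup_subdiffRec_sub (hlam : ∀ k, 0 < lam k) (hT : 0 < T) {w : H}
    (hw : Summable fun k => (ampFrac lam T α k * ⟪φ k, w⟫) ^ 2) (k : ℕ) :
    ⟪φ k, heatSemigroup φ lam T (subdiffRec φ lam T α w) - w⟫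
      = (Real.exp (-lam k * T) * ampFrac lam T α k - 1) * ⟪φ k, w⟫ := by
  rw [inner_sub_right, inner_heatSemigroup hlam hT, subdiffRec, inner_specMul φ hw]
  ring

/-- Locates the worst eigenvalue at index `0`, which makes the explicit signal-to-noise constant
valid for all `k`. -/
theorem one_add_mul_exp_neg_anti {x y : ℝ} (hx : 0 ≤ x) (hxy : x ≤ y) :
    (1 + y) * Real.exp (-y) ≤ (1 + x) * Real.exp (-x) := by
  have h1 : 1 + y ≤ (1 + x) * Real.exp (y - x) := by
    have := Real.add_one_le_exp (y - x)
    nlinarith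
  have h2 : Real.exp (-x) = Real.exp (y - x) * Real.exp (-y) := by
    rw [← Real.exp_add]; congr 1; ring
  rw [h2, ← mul_assoc]
  exact mul_le_mul_of_nonneg_right h1 (Real.exp_pos _).le

theorem one_add_mul_exp_neg_lt_one {x : ℝ} (hx : 0 < x) : (1 + x) * Real.exp (-x) < 1 := by
  have := Real.add_one_lt_exp hx.ne'
  rw [Real.exp_neg, ← div_eq_mul_inv, div_lt_one (Real.exp_pos _)]
  linarith

theorem smoothedLevel_pos {E : Type*} [NormedAddCommGroup E] {C₂ T δ : ℝ} {u₀ : E} (hC₂ : 0 < C₂)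
    (hT : 0 < T) (hδ : 0 < δ) (hδu : δ < ‖u₀‖) : 0 < smoothedLevel C₂ T u₀ δ := by
  have : 0 < Real.log (‖u₀‖ / δ) := Real.log_pos ((one_lt_div hδ).2 hδu)
  have := Real.sqrt_pos.2 this
  rw [smoothedLevel]
  positivity

/-- Under a signal-to-noise condition the discrepancy principle has a solution. -/
theorem exists_discrepancy (hlam : ∀ k, 0 < lam k) (hT : 0 < T) {w : H}
    (hw : ∀ α, 0 < α → α < 1 → Summable fun k => (ampFrac lam T α k * ⟪φ k, w⟫) ^ 2)
    {τ₁ τ₂ dt κ : ℝ} (hτ₁ : 0 < τ₁) (hτ₂ : τ₁ < τ₂) (hdt : 0 < dt) (hκ : 0 < κ)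
    (hκk : ∀ k, κ ≤ |1 - (1 + lam k) * Real.exp (-lam k * T)|) (hsnr : τ₂ / κ * dt < ‖w‖) :
    ∃ α, Discrepancy φ lam T τ₁ τ₂ dt w α := by
  obtain ⟨C, hC0, hC⟩ := exists_exp_div_mittagLeffler_le hT
  set m : ℝ → ℕ → ℝ := fun α k => Real.exp (-lam k * T) * ampFrac lam T α k - 1 with hm
  have hmb : ∀ α, 0 < α → α < 1 → ∀ k, ‖(m α k * ⟪φ k, w⟫) ^ 2‖ ≤ (C + 1) ^ 2 * ⟪φ k, w⟫ ^ 2 := by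
    intro α hα hα1 k
    have h1 := hC α (lam k) hα hα1 (hlam k).le
    have h2 : 0 ≤ Real.exp (-lam k * T) * ampFrac lam T α k :=
      mul_nonneg (Real.exp_pos _).le (ampFrac_pos hlam hT hα hα1 k).le
    rw [norm_pow, norm_mul, mul_pow, Real.norm_eq_abs, Real.norm_eq_abs, sq_abs ⟪φ k, w⟫]
    refine mul_le_mul_of_nonneg_right (pow_le_pow_left₀ (abs_nonneg _) ?_ 2) (sq_nonneg _)
    rw [abs_le]
    change Real.exp (-lam k * T) * ampFrac lam T α k ≤ C at h1
    constructor <;> simp only [hm] <;> linarith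
  have hbs : Summable fun k => (C + 1) ^ 2 * ⟪φ k, w⟫ ^ 2 :=
    (φ.hasSum_sq_inner w).summable.mul_left _
  -- The squared residual norm as a function of the order. The endpoints are excluded, so the
  -- intermediate value theorem is used with limits there.
  set f : ℝ → ℝ := fun α => ∑' k, (m α k * ⟪φ k, w⟫) ^ 2 with hf
  have hcont : ContinuousOn f (Set.Ioo 0 1) := by
    refine continuousOn_tsum (fun k => ?_) hbs fun k α hα => hmb α hα.1 hα.2 k
    exact (((continuousOn_const.mul (continuousOn_ampFrac hlam hT k)).sub
      continuousOn_const).mul continuousOn_const).pow 2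
  have hl1 : Tendsto f (𝓝[Set.Ioo 0 1] 1) (𝓝 0) := by
    have h := tendsto_tsum_of_dominated_convergence (𝓕 := 𝓝[Set.Ioo (0 : ℝ) 1] 1)
      (f := fun α k => (m α k * ⟪φ k, w⟫) ^ 2) (g := fun _ => (0 : ℝ)) hbs (fun k => by
        have h := ((tendsto_exp_mul_ampFrac_one hlam hT k).mul_const ⟪φ k, w⟫).pow 2
        rwa [zero_mul, zero_pow two_ne_zero] at h)
      (by filter_upwards [self_mem_nhdsWithin] with α hα using hmb α hα.1 hα.2)
    simpa using h
  have hl0 : Tendsto f (𝓝[Set.Ioo 0 1] 0)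
      (𝓝 (∑' k, ((Real.exp (-lam k * T) * (1 + lam k) - 1) * ⟪φ k, w⟫) ^ 2)) :=
    tendsto_tsum_of_dominated_convergence hbs (fun k =>
      (((((tendsto_ampFrac_zero hlam hT k).const_mul _).sub_const 1).mul_const ⟪φ k, w⟫).pow 2))
      (by filter_upwards [self_mem_nhdsWithin] with α hα using hmb α hα.1 hα.2)
  have hlow : κ ^ 2 * ‖w‖ ^ 2
      ≤ ∑' k, ((Real.exp (-lam k * T) * (1 + lam k) - 1) * ⟪φ k, w⟫) ^ 2 := by
    have hsum : Summable fun k => ((Real.exp (-lam k * T) * (1 + lam k) - 1) * ⟪φ k, w⟫) ^ 2 := by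
      refine summable_sq_mul_inner φ (C := 1 + 1 / T) (fun k => ?_) w
      have h0 := Real.exp_pos (-lam k * T)
      have h1 : Real.exp (-lam k * T) ≤ 1 := Real.exp_le_one_iff.2 (by nlinarith [hlam k])
      have h2 : lam k * Real.exp (-lam k * T) ≤ 1 / T := by
        rw [le_div_iff₀ hT]
        have := mul_exp_neg_le (y := lam k * T)
        rw [neg_mul]; linarith
      have h3 := mul_pos (hlam k) h0
      have h4 : 0 < 1 / T := by positivity
      rw [abs_le]
      constructor <;> nlinarith
    refine hasSum_le (fun k => ?_) ((φ.hasSum_sq_inner w).mul_left (κ ^ 2)) hsum.hasSum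
    rw [mul_pow]
    refine mul_le_mul_of_nonneg_right ?_ (sq_nonneg _)
    have := hκk k
    rw [abs_sub_comm, mul_comm] at this
    rw [← sq_abs (Real.exp (-lam k * T) * (1 + lam k) - 1)]
    exact pow_le_pow_left₀ hκ.le this 2
  have hlt : τ₁ * dt < κ * ‖w‖ := by
    have h1 : τ₁ * dt < τ₂ * dt := mul_lt_mul_of_pos_right hτ₂ hdt
    have h2 := mul_lt_mul_of_pos_left hsnr hκ
    have h3 : κ * (τ₂ / κ * dt) = τ₂ * dt := by field_simp
    linarith
  have hpos : 0 < τ₁ * dt := mul_pos hτ₁ hdt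
  have : (𝓝[Set.Ioo (0 : ℝ) 1] 1).NeBot := right_nhdsWithin_Ioo_neBot zero_lt_one
  have : (𝓝[Set.Ioo (0 : ℝ) 1] 0).NeBot := left_nhdsWithin_Ioo_neBot zero_lt_one
  obtain ⟨α, hα, hαf⟩ := isPreconnected_Ioo.intermediate_value_Ioo
    (l₁ := 𝓝[Set.Ioo (0 : ℝ) 1] 1) (l₂ := 𝓝[Set.Ioo (0 : ℝ) 1] 0) inf_le_right inf_le_right hcont
    hl1 hl0 (show (τ₁ * dt) ^ 2 ∈ Set.Ioo _ _ from ⟨by positivity, by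
      refine lt_of_lt_of_le ?_ hlow
      rw [← mul_pow]
      exact pow_lt_pow_left₀ hlt hpos.le two_ne_zero⟩)
  have hnorm : ‖heatSemigroup φ lam T (subdiffRec φ lam T α w) - w‖ = τ₁ * dt := by
    have h1 := (φ.hasSum_sq_inner (heatSemigroup φ lam T (subdiffRec φ lam T α w) - w)).tsum_eq
    simp only [inner_heatSemigroup_subdiffRec_sub hlam hT (hw α hα.1 hα.2)] at h1
    have h2 : ‖heatSemigroup φ lam T (subdiffRec φ lam T α w) - w‖ ^ 2 = (τ₁ * dt) ^ 2 :=
      h1.symm.trans hαf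
    exact (sq_eq_sq₀ (norm_nonneg _) hpos.le).1 h2
  refine ⟨α, hα.1, hα.2, hnorm.ge, hnorm.le.trans ?_⟩
  exact mul_le_mul_of_nonneg_right hτ₂.le hdt.le

theorem summable_sq_one_add_mul_inner_of_memHdot (hlam : ∀ k, 0 < lam k) (hmono : Monotone lam)
    {r : ℝ} (hr : 2 ≤ r) {u : H} (hu : MemHdot φ lam r u) :
    Summable fun k => ((1 + lam k) * ⟪φ k, u⟫) ^ 2 := by
  refine Summable.of_nonneg_of_le (fun k => sq_nonneg _) (fun k => ?_)
    (((φ.hasSum_sq_inner u).summable.mul_left 2).add (hu.mul_left (2 * lam 0 ^ (2 - r))))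
  have h1 : lam k ^ 2 ≤ lam 0 ^ (2 - r) * lam k ^ r := by
    have h2 : lam k ^ (2 - r) ≤ lam 0 ^ (2 - r) :=
      Real.rpow_le_rpow_of_nonpos (hlam 0) (hmono k.zero_le) (by linarith)
    calc lam k ^ 2 = lam k ^ (2 - r) * lam k ^ r := by
          rw [← Real.rpow_add (hlam k), ← Real.rpow_natCast]; congr 1; norm_num
      _ ≤ _ := mul_le_mul_of_nonneg_right h2 (Real.rpow_nonneg (hlam k).le _)
  have h3 : (1 + lam k) ^ 2 ≤ 2 + 2 * lam k ^ 2 := by nlinarith [sq_nonneg (1 - lam k)]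
  calc ((1 + lam k) * ⟪φ k, u⟫) ^ 2 = (1 + lam k) ^ 2 * ⟪φ k, u⟫ ^ 2 := by ring
    _ ≤ (2 + 2 * (lam 0 ^ (2 - r) * lam k ^ r)) * ⟪φ k, u⟫ ^ 2 :=
        mul_le_mul_of_nonneg_right (by linarith) (sq_nonneg _)
    _ = _ := by ring

/-- `log z ≤ z` gives `δ² log (a / δ) ≤ a δ`. -/
theorem tendsto_mul_sqrt_log_div {ι : Type*} {l : Filter ι} {a : ℝ} (ha : 0 < a) {δ : ι → ℝ}
    (hδ : ∀ n, 0 < δ n) (h : Tendsto δ l (𝓝 0)) :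
    Tendsto (fun n => δ n * √(Real.log (a / δ n))) l (𝓝 0) := by
  have h1 : Tendsto (fun n => √(a * δ n)) l (𝓝 0) := by
    simpa using (h.const_mul a).sqrt
  refine squeeze_zero (fun n => mul_nonneg (hδ n).le (Real.sqrt_nonneg _)) (fun n => ?_) h1
  refine Real.le_sqrt_of_sq_le ?_
  have hpos : 0 < a / δ n := div_pos ha (hδ n)
  have h2 : √(Real.log (a / δ n)) ^ 2 ≤ a / δ n := by
    rcases le_total 0 (Real.log (a / δ n)) with h0 | h0
    · rw [Real.sq_sqrt h0]
      linarith [Real.log_le_sub_one_of_pos hpos]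
    · rw [Real.sqrt_eq_zero_of_nonpos h0]
      simpa using hpos.le
  calc (δ n * √(Real.log (a / δ n))) ^ 2 = δ n ^ 2 * √(Real.log (a / δ n)) ^ 2 := by ring
    _ ≤ δ n ^ 2 * (a / δ n) := mul_le_mul_of_nonneg_left h2 (sq_nonneg _)
    _ = a * δ n := by have := (hδ n).ne'; field_simp

theorem tendsto_log_div_atTop {ι : Type*} {l : Filter ι} {a : ℝ} (ha : 0 < a) {δ : ι → ℝ}
    (hδ : ∀ n, 0 < δ n) (h : Tendsto δ l (𝓝 0)) :
    Tendsto (fun n => Real.log (a / δ n)) l atTop := by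
  have h0 : Tendsto δ l (𝓝[>] 0) :=
    tendsto_nhdsWithin_iff.2 ⟨h, Eventually.of_forall hδ⟩
  exact Real.tendsto_log_atTop.comp ((tendsto_inv_nhdsGT_zero.comp h0).const_mul_atTop ha)

end Reconstruction

/-! ### Boundedness and weak convergence of the reconstructions -/

section Convergence

variable {H : Type*} [NormedAddCommGroup H] [InnerProductSpace ℝ H] {φ : HilbertBasis ℕ ℝ H}
  {lam : ℕ → ℝ} {s μ T α : ℝ}

theorem inner_eq_exp_mul_inner_sub (hlam : ∀ k, 0 < lam k) (hT : 0 < T) (u₀ gδ : H) (k : ℕ) :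
    ⟪φ k, gδ⟫ = Real.exp (-lam k * T) * ⟪φ k, u₀⟫ - ⟪φ k, heatSemigroup φ lam T u₀ - gδ⟫ := by
  rw [inner_sub_right, inner_heatSemigroup hlam hT]
  ring

/-- The exact part carries `e^{-λ_k T}` and is bounded uniformly in `α`; only the noise part sees
the factor `1 / (1 - α)`. -/
theorem norm_subdiffRec_landweber_le (hlam : ∀ k, 0 < lam k) (hμ : 0 < μ)
    (hθ : ∀ k, μ * lam k ^ (-(2 * s)) ≤ 1) (hmono : Monotone lam) (hs : 1 ≤ s) (hT : 0 < T)
    (hα : 0 < α) (hα1 : α < 1) {C : ℝ}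
    (hC : ∀ k, Real.exp (-lam k * T) * ampFrac lam T α k ≤ C) {u₀ gδ : H} {δ : ℝ}
    (hδ : ‖heatSemigroup φ lam T u₀ - gδ‖ ≤ δ) (i : ℕ) :
    ‖subdiffRec φ lam T α (landweber φ lam s μ gδ i)‖ ≤ C * ‖u₀‖ +
      (1 + (1 + T) * (1 / (1 - α)) * √(i * (μ * lam 0 ^ (2 - 2 * s)))) * δ := by
  have hB : 0 ≤ 1 + (1 + T) * (1 / (1 - α)) * √(i * (μ * lam 0 ^ (2 - 2 * s))) := by
    have : 0 < 1 - α := by linarith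
    positivity
  have hexp : ∀ k, 0 ≤ Real.exp (-lam k * T) * ampFrac lam T α k := fun k =>
    mul_nonneg (Real.exp_pos _).le (ampFrac_pos hlam hT hα hα1 k).le
  refine (φ.norm_le_add_of_abs_inner_le (y := u₀) (z := heatSemigroup φ lam T u₀ - gδ)
    ((hexp 0).trans (hC 0)) hB fun k => ?_).trans
    (add_le_add le_rfl (mul_le_mul_of_nonneg_left hδ hB))
  obtain ⟨q0, q1⟩ := landweberFilter_mem_Icc hlam hμ hθ i k
  have hamp := (ampFrac_pos hlam hT hα hα1 k).le
  rw [subdiffRec, inner_specMul φ (summable_sq_ampFrac_mul_inner_landweber hlam hμ hθ hmono hs hT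
    hα hα1 gδ i), inner_landweber hlam hmono (by linarith),
    inner_eq_exp_mul_inner_sub (φ := φ) hlam hT u₀ gδ k]
  set z := ⟪φ k, heatSemigroup φ lam T u₀ - gδ⟫
  rw [show ampFrac lam T α k * (landweberFilter lam s μ i k *
      (Real.exp (-lam k * T) * ⟪φ k, u₀⟫ - z))
      = landweberFilter lam s μ i k * (Real.exp (-lam k * T) * ampFrac lam T α k) * ⟪φ k, u₀⟫
        - ampFrac lam T α k * landweberFilter lam s μ i k * z by ring]
  refine (abs_sub _ _).trans ?_
  rw [abs_mul, abs_mul _ z, abs_of_nonneg (mul_nonneg q0 (hexp k)),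
    abs_of_nonneg (mul_nonneg hamp q0)]
  refine add_le_add (mul_le_mul_of_nonneg_right ?_ (abs_nonneg _))
    (mul_le_mul_of_nonneg_right ?_ (abs_nonneg _))
  · exact (mul_le_of_le_one_left (hexp k) q1).trans (hC k)
  · exact ampFrac_mul_landweberFilter_le hlam hμ hθ hmono hs hT hα hα1 i k

/-- The exact part gains `1 - α` and loses one power of `λ_k`, which `y`, playing the role of `(1 -
𝕃) u₀`, absorbs. -/
theorem norm_residual_landweber_le (hlam : ∀ k, 0 < lam k) (hμ : 0 < μ)
    (hθ : ∀ k, μ * lam k ^ (-(2 * s)) ≤ 1) (hmono : Monotone lam) (hs : 1 ≤ s) (hT : 0 < T)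
    (hα : 0 < α) (hα1 : α < 1) {C : ℝ}
    (hC : ∀ k, Real.exp (-lam k * T) * ampFrac lam T α k ≤ C) {u₀ y gδ : H} {δ : ℝ}
    (hy : ∀ k, ⟪φ k, y⟫ = (1 + lam k) * ⟪φ k, u₀⟫)
    (hδ : ‖heatSemigroup φ lam T u₀ - gδ‖ ≤ δ) (i : ℕ) :
    ‖heatSemigroup φ lam T (subdiffRec φ lam T α (landweber φ lam s μ gδ i))
        - landweber φ lam s μ gδ i‖
      ≤ C * (2 * (4 + 2 * T + T ^ 2) * (1 - α)) * ‖y‖ + (C + 1) * δ := by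
  have hexp : ∀ k, 0 ≤ Real.exp (-lam k * T) * ampFrac lam T α k := fun k =>
    mul_nonneg (Real.exp_pos _).le (ampFrac_pos hlam hT hα hα1 k).le
  have hC0 : 0 ≤ C := (hexp 0).trans (hC 0)
  have hA : 0 ≤ C * (2 * (4 + 2 * T + T ^ 2) * (1 - α)) :=
    mul_nonneg hC0 (mul_nonneg (by positivity) (by linarith))
  refine (φ.norm_le_add_of_abs_inner_le (y := y) (z := heatSemigroup φ lam T u₀ - gδ)
    hA (by linarith : 0 ≤ C + 1) fun k => ?_).trans
    (add_le_add le_rfl (mul_le_mul_of_nonneg_left hδ (by linarith)))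
  obtain ⟨q0, q1⟩ := landweberFilter_mem_Icc hlam hμ hθ i k
  rw [inner_heatSemigroup_subdiffRec_sub hlam hT (summable_sq_ampFrac_mul_inner_landweber hlam hμ
    hθ hmono hs hT hα hα1 gδ i), inner_landweber hlam hmono (by linarith),
    inner_eq_exp_mul_inner_sub (φ := φ) hlam hT u₀ gδ k, hy]
  set z := ⟪φ k, heatSemigroup φ lam T u₀ - gδ⟫
  set m := Real.exp (-lam k * T) * ampFrac lam T α k - 1 with hm
  have hmle : |m| ≤ C + 1 := by
    have := hexp k
    have := hC k
    rw [abs_le]; constructor <;> linarith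
  have hme : |m| * Real.exp (-lam k * T)
      ≤ C * (2 * (4 + 2 * T + T ^ 2) * (1 - α) * (1 + lam k)) :=
    abs_exp_mul_ampFrac_sub_one_mul_exp_le hlam hT hα hα1 k (hC k)
  have hme0 : 0 ≤ |m| * Real.exp (-lam k * T) := mul_nonneg (abs_nonneg _) (Real.exp_pos _).le
  have h1l : 0 < 1 + lam k := by linarith [hlam k]
  rw [show m * (landweberFilter lam s μ i k * (Real.exp (-lam k * T) * ⟪φ k, u₀⟫ - z))
      = landweberFilter lam s μ i k * (m * Real.exp (-lam k * T)) * ⟪φ k, u₀⟫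
        - landweberFilter lam s μ i k * m * z by ring]
  refine (abs_sub _ _).trans ?_
  rw [abs_mul, abs_mul _ z, abs_mul, abs_mul, abs_mul, abs_mul, abs_of_nonneg q0,
    abs_of_pos (Real.exp_pos _), abs_of_pos h1l, ← mul_assoc,
    ← mul_assoc _ (1 + lam k)]
  refine add_le_add (mul_le_mul_of_nonneg_right ?_ (abs_nonneg _))
    (mul_le_mul_of_nonneg_right ?_ (abs_nonneg _))
  · rw [mul_assoc _ |m|]
    exact (mul_le_of_le_one_left hme0 q1).trans (hme.trans_eq (by ring))
  · exact (mul_le_of_le_one_left (abs_nonneg _) q1).trans hmle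

theorem tendsto_inner_subdiffRec_landweber (hlam : ∀ k, 0 < lam k) (hμ : 0 < μ)
    (hθ : ∀ k, μ * lam k ^ (-(2 * s)) ≤ 1) (hmono : Monotone lam) (hs : 1 ≤ s) (hT : 0 < T)
    {u₀ : H} (hu₀ : u₀ ≠ 0) (hreg : Summable fun k => ((1 + lam k) * ⟪φ k, u₀⟫) ^ 2)
    {C₂ τ₁ τ₂ : ℝ} (hC₂ : 0 < C₂) (hτ₁ : 0 < τ₁) {δ : ℕ → ℝ} {gδ : ℕ → H} {i : ℕ → ℕ} {α : ℕ → ℝ}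
    (hδ : ∀ n, 0 < δ n) (hδ0 : Tendsto δ atTop (𝓝 0))
    (hg : ∀ n, ‖heatSemigroup φ lam T u₀ - gδ n‖ ≤ δ n)
    (hi : (fun n => (i n : ℝ)) =Θ[atTop] fun n => (T ^ 2)⁻¹ * Real.log (‖u₀‖ / δ n))
    (hD : ∀ᶠ n in atTop, Discrepancy φ lam T τ₁ τ₂ (smoothedLevel C₂ T u₀ (δ n))
      (landweber φ lam s μ (gδ n) (i n)) (α n)) (v : H) :
    Tendsto (fun n => ⟪subdiffRec φ lam T (α n) (landweber φ lam s μ (gδ n) (i n)), v⟫)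
      atTop (𝓝 ⟪u₀, v⟫) := by
  obtain ⟨C, hC0, hC⟩ := exists_exp_div_mittagLeffler_le hT
  have hu : 0 < ‖u₀‖ := norm_pos_iff.2 hu₀
  obtain ⟨y, -, hy⟩ := φ.hasSum_of_summable_sq hreg
  have hL := tendsto_log_div_atTop hu hδ hδ0
  have hLs : Tendsto (fun n => √(Real.log (‖u₀‖ / δ n))) atTop atTop :=
    Real.tendsto_sqrt_atTop.comp hL
  have hTL : Tendsto (fun n => (T ^ 2)⁻¹ * Real.log (‖u₀‖ / δ n)) atTop atTop :=
    hL.const_mul_atTop (by positivity)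
  have hitop : Tendsto i atTop atTop := by
    obtain ⟨c, hc0, hc⟩ := hi.2.exists_pos
    rw [isBigOWith_iff] at hc
    refine tendsto_natCast_atTop_iff.1 (tendsto_atTop_mono' _ ?_
      (hTL.const_mul_atTop (inv_pos.2 hc0)))
    filter_upwards [hc] with n hn
    rw [inv_mul_le_iff₀ hc0]
    refine (le_abs_self _).trans (hn.trans_eq ?_)
    rw [Real.norm_of_nonneg (Nat.cast_nonneg _)]
  have hKpos : 0 < μ * lam 0 ^ (2 - 2 * s) := mul_pos hμ (Real.rpow_pos_of_pos (hlam 0) _)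
  set K := μ * lam 0 ^ (2 - 2 * s) with hK
  obtain ⟨C₁, hC₁, hsqrt⟩ : ∃ C₁, 0 < C₁ ∧ ∀ᶠ n in atTop,
      √(i n * K) ≤ C₁ * √(Real.log (‖u₀‖ / δ n)) := by
    obtain ⟨c, hc0, hc⟩ := hi.1.exists_pos
    rw [isBigOWith_iff] at hc
    have hpos : 0 < c * (T ^ 2)⁻¹ * K := by positivity
    refine ⟨√(c * (T ^ 2)⁻¹ * K), Real.sqrt_pos.2 hpos, ?_⟩
    filter_upwards [hc, hTL.eventually_ge_atTop 0] with n hn hn0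
    rw [← Real.sqrt_mul hpos.le]
    refine Real.sqrt_le_sqrt ?_
    rw [Real.norm_of_nonneg (Nat.cast_nonneg _), Real.norm_of_nonneg hn0] at hn
    exact (mul_le_mul_of_nonneg_right hn hKpos.le).trans_eq (by ring)
  have hc₀ : 0 < τ₁ * (C₂ * T⁻¹) := by positivity
  set c₀ := τ₁ * (C₂ * T⁻¹) with hc₀def
  -- The `2` comes from absorption: once `√log ≥ 2 * (C + 1) / c₀`, the noise term `(C + 1) * δ` is
  -- at most half of the lower discrepancy bound.
  set M := 2 * (C * (2 * (4 + 2 * T + T ^ 2)) * ‖y‖) / c₀ with hM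
  -- The lower discrepancy bound controls the noise level by the distance of the order from one.
  have hnoise : ∀ᶠ n in atTop, δ n * √(Real.log (‖u₀‖ / δ n)) ≤ M * (1 - α n) := by
    filter_upwards [hD, hLs.eventually_ge_atTop (2 * (C + 1) / c₀)] with n hn hnL
    obtain ⟨hα, hα1, hlow, -⟩ := hn
    have h1 := norm_residual_landweber_le (φ := φ) hlam hμ hθ hmono hs hT hα hα1
      (fun k => hC (α n) (lam k) hα hα1 (hlam k).le) hy (hg n) (i n)
    have h2 := hlow.trans h1
    rw [div_le_iff₀ hc₀] at hnL
    have h3 := mul_le_mul_of_nonneg_left hnL (hδ n).le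
    have h4 : τ₁ * smoothedLevel C₂ T u₀ (δ n)
        = c₀ * (δ n * √(Real.log (‖u₀‖ / δ n))) := by
      rw [smoothedLevel, hc₀def]; ring
    rw [hM, div_mul_eq_mul_div, le_div_iff₀ hc₀]
    rw [h4] at h2
    linarith
  have hbdd : ∀ᶠ n in atTop, ‖subdiffRec φ lam T (α n) (landweber φ lam s μ (gδ n) (i n))‖
      ≤ C * ‖u₀‖ + (1 + (1 + T) * C₁ * M) := by
    filter_upwards [hD, hnoise, hsqrt, hδ0.eventually_le_const one_pos] with n hn h1 h2 h3
    obtain ⟨hα, hα1, -, -⟩ := hn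
    have hη : 0 < 1 - α n := by linarith
    refine (norm_subdiffRec_landweber_le (φ := φ) hlam hμ hθ hmono hs hT hα hα1
      (fun k => hC (α n) (lam k) hα hα1 (hlam k).le) (hg n) (i n)).trans ?_
    refine add_le_add le_rfl ?_
    have h4 : δ n * √(Real.log (‖u₀‖ / δ n)) / (1 - α n) ≤ M := (div_le_iff₀ hη).2 h1
    calc (1 + (1 + T) * (1 / (1 - α n)) * √(i n * K)) * δ n
        ≤ (1 + (1 + T) * (1 / (1 - α n)) * (C₁ * √(Real.log (‖u₀‖ / δ n)))) * δ n := by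
          have := (hδ n).le
          gcongr
      _ = δ n + (1 + T) * C₁ * (δ n * √(Real.log (‖u₀‖ / δ n)) / (1 - α n)) := by
          field_simp
      _ ≤ 1 + (1 + T) * C₁ * M :=
          add_le_add h3 (mul_le_mul_of_nonneg_left h4 (by positivity))
  refine φ.tendsto_inner_of_tendsto_coeff hbdd (fun k => ?_) v
  have hE := Real.exp_pos (-lam k * T)
  have hlevel : Tendsto (fun n => τ₂ * smoothedLevel C₂ T u₀ (δ n)) atTop (𝓝 0) := by
    have h := (tendsto_mul_sqrt_log_div hu hδ hδ0).const_mul (τ₂ * (C₂ * T⁻¹))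
    rw [mul_zero] at h
    refine h.congr fun n => ?_
    rw [smoothedLevel]; ring
  have hw : Tendsto (fun n => ⟪φ k, landweber φ lam s μ (gδ n) (i n)⟫) atTop
      (𝓝 (Real.exp (-lam k * T) * ⟪φ k, u₀⟫)) := by
    have hz : Tendsto (fun n => ⟪φ k, heatSemigroup φ lam T u₀ - gδ n⟫) atTop (𝓝 0) := by
      refine squeeze_zero_norm (fun n => ?_) hδ0
      refine (norm_inner_le_norm _ _).trans ?_
      rw [φ.orthonormal.1 k, one_mul]
      exact hg n
    have h := (tendsto_landweberFilter hlam hμ hθ hitop k).mul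
      (hz.const_sub (Real.exp (-lam k * T) * ⟪φ k, u₀⟫))
    rw [sub_zero, one_mul] at h
    refine h.congr fun n => ?_
    rw [inner_landweber hlam hmono (by linarith), ← inner_eq_exp_mul_inner_sub hlam hT]
  have hr : Tendsto (fun n => ⟪φ k, heatSemigroup φ lam T (subdiffRec φ lam T (α n)
      (landweber φ lam s μ (gδ n) (i n))) - landweber φ lam s μ (gδ n) (i n)⟫) atTop (𝓝 0) := by
    refine squeeze_zero_norm' ?_ hlevel
    filter_upwards [hD] with n hn
    refine (norm_inner_le_norm _ _).trans ?_
    rw [φ.orthonormal.1 k, one_mul]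
    exact hn.2.2.2
  -- For fixed `k` the backward heat factor is a constant, so inverting it preserves the limit.
  have h := (hr.add hw).const_mul (Real.exp (-lam k * T))⁻¹
  rw [zero_add, inv_mul_cancel_left₀ hE.ne'] at h
  refine h.congr fun n => ?_
  rw [inner_sub_right, sub_add_cancel, inner_heatSemigroup hlam hT, inv_mul_cancel_left₀ hE.ne']

end Convergence

/-! ### The main theorem -/

theorem mainTheorem2 {d : ℕ} (Ω : Set (EucSp d)) (hΩo : IsOpen Ω) (hΩc : IsConnected Ω)
    (hΩb : Bornology.IsBounded Ω)
    (L : EllipticOp Ω) (φ : HilbertBasis ℕ ℝ (L2 Ω)) (lam : ℕ → ℝ)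
    (hφ : L.IsEigenSystem φ lam)
    (T : ℝ) (hT : 0 < T) (p : ℝ) (hp : 1 < p)
    (u₀ : L2 Ω) (hu₀ : u₀ ≠ 0) (hu₀reg : MemHdot φ lam (2 * (1 + 2 / p)) u₀)
    (s μ : ℝ) (hs : 1 + 1 / p ≤ s) (hμ : 0 < μ)
    (hA : ∀ v, ‖smoothingOp φ lam s μ v‖ ≤ ‖v‖)
    (C₂ : ℝ) (hC₂ : 0 < C₂) (τ₁ τ₂ : ℝ) (hτ₁ : 1 < τ₁) (hτ₂ : τ₁ < τ₂) :
    -- the series defining the reconstruction converges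
    (∀ (gδ : L2 Ω) (i : ℕ) (α : ℝ), 0 < α → α < 1 →
      Summable fun k => (ampFrac lam T α k * ⟪φ k, landweber φ lam s μ gδ i⟫) • φ k) ∧
    -- existence of a parameter that satisfies the discrepancy principle
    (∀ (gδ : L2 Ω) (i : ℕ) (δ : ℝ), 0 < δ → δ < ‖u₀‖ →
      ((∃ κ : ℝ, 0 < κ ∧ (∀ k, κ ≤ |1 - (1 + lam k) * Real.exp (-lam k * T)|) ∧
          τ₂ / κ * smoothedLevel C₂ T u₀ δ < ‖landweber φ lam s μ gδ i‖) ∨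
        (1 ≤ T ∧ τ₂ / (1 - (1 + lam 0 * T) * Real.exp (-lam 0 * T)) *
          smoothedLevel C₂ T u₀ δ < ‖landweber φ lam s μ gδ i‖)) →
      ∃ α, Discrepancy φ lam T τ₁ τ₂ (smoothedLevel C₂ T u₀ δ) (landweber φ lam s μ gδ i) α) ∧
    -- weak convergence of the reconstructions as the noise level tends to zero
    (∀ (δ : ℕ → ℝ) (gδ : ℕ → L2 Ω) (i : ℕ → ℕ) (α : ℕ → ℝ),
      (∀ n, 0 < δ n) → Tendsto δ atTop (𝓝 0) →
      (∀ n, ‖heatSemigroup φ lam T u₀ - gδ n‖ ≤ δ n) →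
      ((fun n => (i n : ℝ)) =Θ[atTop] fun n => (T ^ 2)⁻¹ * Real.log (‖u₀‖ / δ n)) →
      (∀ᶠ n in atTop, Discrepancy φ lam T τ₁ τ₂ (smoothedLevel C₂ T u₀ (δ n))
        (landweber φ lam s μ (gδ n) (i n)) (α n)) →
      ∀ v : L2 Ω, Tendsto
        (fun n => ⟪subdiffRec φ lam T (α n) (landweber φ lam s μ (gδ n) (i n)), v⟫)
        atTop (𝓝 ⟪u₀, v⟫)) := by
  obtain ⟨-, hlam, hmono⟩ := hφ
  have hp0 : 0 < p := by linarith
  have hs1 : 1 ≤ s := by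
    have : 0 < 1 / p := by positivity
    linarith
  have hθ := mul_rpow_le_one_of_norm_smoothingOp_le hlam hmono (by linarith) hA
  refine ⟨fun gδ i α hα hα1 => ?_, fun gδ i δ hδ hδu hsnr => ?_,
    fun δ gδ i α hδ hδ0 hg hi hD v => ?_⟩
  · obtain ⟨x, hx, -⟩ := φ.hasSum_of_summable_sq
      (summable_sq_ampFrac_mul_inner_landweber hlam hμ hθ hmono hs1 hT hα hα1 gδ i)
    exact hx.summable
  · have hsum := fun α hα hα1 => summable_sq_ampFrac_mul_inner_landweber (φ := φ) (α := α)
      hlam hμ hθ hmono hs1 hT hα hα1 gδ i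
    have hdt := smoothedLevel_pos hC₂ hT hδ hδu
    rcases hsnr with ⟨κ, hκ, hκk, hlt⟩ | ⟨hT1, hlt⟩
    · exact exists_discrepancy hlam hT hsum (by linarith) hτ₂ hdt hκ hκk hlt
    · have h0 := one_add_mul_exp_neg_lt_one (mul_pos (hlam 0) hT)
      rw [← neg_mul] at h0
      refine exists_discrepancy hlam hT hsum (by linarith) hτ₂ hdt (by linarith) (fun k => ?_) hlt
      have h1 := one_add_mul_exp_neg_anti (mul_pos (hlam 0) hT).le
        (mul_le_mul_of_nonneg_right (hmono k.zero_le) hT.le)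
      rw [← neg_mul, ← neg_mul] at h1
      -- Here `T ≥ 1` enters, through `λ_k ≤ λ_k T`.
      have h2 : (1 + lam k) * Real.exp (-lam k * T) ≤ (1 + lam k * T) * Real.exp (-lam k * T) :=
        mul_le_mul_of_nonneg_right (by nlinarith [hlam k]) (Real.exp_pos _).le
      exact le_trans (by linarith) (le_abs_self _)
  · have hreg := summable_sq_one_add_mul_inner_of_memHdot hlam hmono
      (by have : 0 < 2 / p := by positivity
          linarith) hu₀reg
    exact tendsto_inner_subdiffRec_landweber hlam hμ hθ hmono hs1 hT hu₀ hreg hC₂ (by linarith)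
      hδ hδ0 hg hi hD v
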